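/- Let $\mathbf{Top}$ be the category of $\Delta$-generated spaces, or the category of $\Delta$-Hausdorff $\Delta$-generated spaces (those in which the image of every path is closed). A multipointed $d$-space $X=(|X|,X^0,\mathbb{P}^{top}X)$ consists of a space $|X|$ of $\mathbf{Top}$, a set of states $X^0\subset|X|$ and a set $\mathbb{P}^{top}X$ of continuous maps $[0,1]\to|X|$ (execution paths) with endpoints in $X^0$, closed under precomposition with nondecreasing surjective maps $[0,1]\to[0,1]$ and under normalized composition $(\gamma_1*_N\gamma_2)(t)=\gamma_1(2t)$ for $t\le 1/2$, $\gamma_2(2t-1)$ for $t\ge 1/2$. A map is a continuous map of underlying spaces preserving states and execution paths. A directed path of $X$ is a path that belongs to the smallest set of paths of $|X|$ that contains the constant paths and the execution paths of $X$ and is closed under normalized composition and under precomposition with nondecreasing continuous maps $[0,1]\to[0,1]$. A set $S$ is identified with $(S,S,\varnothing)$, $S$ discrete. For a space $Z$, the globe ${\rm Glob}^{top}(Z)$ has underlying space the quotient of $\{0,1\}\sqcup (Z\times[0,1])$ by $(z,0)=0$, $(z,1)=1$, states $\{0,1\}$, and execution paths $t\mapsto(z,\phi(t))$ with $z\in Z$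 and $\phi:[0,1]\to[0,1]$ nondecreasing surjective. Let $\mathbf{D}^n\subset\mathbb{R}^n$ be the closed unit disk, $\mathbf{S}^{n-1}$ the unit sphere ($\mathbf{D}^0$ is a point, $\mathbf{S}^{-1}=\varnothing$), and $I^{gl,top}=\{{\rm Glob}^{top}(\mathbf{S}^{k-1})\subset{\rm Glob}^{top}(\mathbf{D}^k)\mid k\ge 0\}$, $C:\varnothing\to\{0\}$, $R:\{0,1\}\to\{0\}$. A multipointed $d$-space $X$ is cellular if $\varnothing\to X$ is a transfinite composition of pushouts of maps of $I^{gl,top}\cup\{C,R\}$. **Proposition.** Let $n\ge 0$ and let $F$ be a finite subset of $|{\rm Glob}^{top}(\mathbf{D}^n)|\setminus|{\rm Glob}^{top}(\mathbf{S}^{n-1})|$. Let ${\rm Glob}^{top}(\mathbf{D}^n)_F$ be the multipointed $d$-space with underlying space $|{\rm Glob}^{top}(\mathbf{D}^n)|$, set of states $\{0,1\}\cup F$, and whose execution paths from $\alpha$ to $\beta$, for states $\alpha\ne\beta$, are the directed paths of ${\rm Glob}^{top}(\mathbf{D}^n)$ from $\alpha$ to $\beta$, there being no execution path from a state to itself.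 Then the inclusion ${\rm Glob}^{top}(\mathbf{S}^{n-1})\subset{\rm Glob}^{top}(\mathbf{D}^n)_F$ is a finite composition of pushouts of maps of $I^{gl,top}\cup\{C\}$, and ${\rm Glob}^{top}(\mathbf{D}^n)_F$ is cellular. This holds for both choices of $\mathbf{Top}$. -/

import Mathlib

open CategoryTheory

/-- Normalized composition of two paths: `γ₁ (2t)` for `t ≤ 1/2`, then `γ₂ (2t - 1)`. -/
noncomputable def normComp {X : Type} [TopologicalSpace X] (γ₁ γ₂ : C(unitInterval, X))
    (h : γ₁ 1 = γ₂ 0) : C(unitInterval, X) :=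
  ((⟨γ₁, rfl, h⟩ : Path (γ₁ 0) (γ₂ 0)).trans
    (⟨γ₂, rfl, rfl⟩ : Path (γ₂ 0) (γ₂ 1))).toContinuousMap

theorem normComp_apply {X : Type} [TopologicalSpace X] (γ₁ γ₂ : C(unitInterval, X))
    (h : γ₁ 1 = γ₂ 0) (t : unitInterval) :
    normComp γ₁ γ₂ h t = if ht : (t : ℝ) ≤ 1 / 2 then
        γ₁ ⟨2 * t, (unitInterval.mul_pos_mem_iff zero_lt_two).2 ⟨t.2.1, ht⟩⟩
      else γ₂ ⟨2 * t - 1, unitInterval.two_mul_sub_one_mem_iff.2 ⟨(not_le.1 ht).le, t.2.2⟩⟩ :=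
  Path.trans_apply _ _ _

theorem normComp_zero {X : Type} [TopologicalSpace X] (γ₁ γ₂ : C(unitInterval, X))
    (h : γ₁ 1 = γ₂ 0) : normComp γ₁ γ₂ h 0 = γ₁ 0 :=
  Path.source _

theorem normComp_one {X : Type} [TopologicalSpace X] (γ₁ γ₂ : C(unitInterval, X))
    (h : γ₁ 1 = γ₂ 0) : normComp γ₁ γ₂ h 1 = γ₂ 1 :=
  Path.target _

theorem comp_normComp {X Y : Type} [TopologicalSpace X] [TopologicalSpace Y] (f : C(X, Y))
    (γ₁ γ₂ : C(unitInterval, X)) (h : γ₁ 1 = γ₂ 0) :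
    f.comp (normComp γ₁ γ₂ h) =
      normComp (f.comp γ₁) (f.comp γ₂) (congrArg f h) := by
  ext t
  simp only [ContinuousMap.comp_apply, normComp_apply]
  split_ifs <;> rfl

/-- The set `𝓜` of nondecreasing surjective (hence continuous) self-maps of `[0,1]`. -/
def reparamM : Set C(unitInterval, unitInterval) :=
  {φ | Monotone φ ∧ Function.Surjective φ}

/-- The set of nondecreasing continuous self-maps of `[0,1]`. -/
def reparamI : Set C(unitInterval, unitInterval) :=
  {φ | Monotone φ}

theorem reparamM_zero {φ : C(unitInterval, unitInterval)} (h : φ ∈ reparamM) : φ 0 = 0 := by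
  obtain ⟨s, hs⟩ := h.2 0
  have h' : φ 0 ≤ φ s := h.1 unitInterval.nonneg'
  exact le_antisymm (h'.trans hs.le) unitInterval.nonneg'

theorem reparamM_one {φ : C(unitInterval, unitInterval)} (h : φ ∈ reparamM) : φ 1 = 1 := by
  obtain ⟨s, hs⟩ := h.2 1
  have h' : φ s ≤ φ 1 := h.1 unitInterval.le_one'
  exact le_antisymm unitInterval.le_one' (hs.ge.trans h')

theorem reparamM_comp {φ ψ : C(unitInterval, unitInterval)} (h : φ ∈ reparamM)
    (h' : ψ ∈ reparamM) : φ.comp ψ ∈ reparamM :=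
  ⟨h.1.comp h'.1, h.2.comp h'.2⟩

/-- A multipointed `d`-space. -/
structure MDSpace : Type 1 where
  /-- the underlying space, a `Δ`-generated space -/
  carrier : Type
  [top : TopologicalSpace carrier]
  [deltaGenerated : DeltaGeneratedSpace carrier]
  /-- the set of states -/
  states : Set carrier
  /-- the set of execution paths -/
  execPaths : Set C(unitInterval, carrier)
  source_mem : ∀ γ ∈ execPaths, γ 0 ∈ states
  target_mem : ∀ γ ∈ execPaths, γ 1 ∈ states
  reparam_mem : ∀ γ ∈ execPaths, ∀ φ ∈ reparamM, γ.comp φ ∈ execPaths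
  comp_mem : ∀ γ₁ ∈ execPaths, ∀ γ₂ ∈ execPaths, ∀ h : γ₁ 1 = γ₂ 0,
    normComp γ₁ γ₂ h ∈ execPaths

attribute [instance] MDSpace.top MDSpace.deltaGenerated

namespace MDSpace

/-- The set of execution paths from `α` to `β`. -/
def execFrom (X : MDSpace) (α β : X.carrier) : Set C(unitInterval, X.carrier) :=
  {γ | γ ∈ X.execPaths ∧ γ 0 = α ∧ γ 1 = β}

/-- A map of multipointed `d`-spaces. -/
@[ext]
structure Hom (X Y : MDSpace) : Type where
  map : C(X.carrier, Y.carrier)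
  map_states : ∀ x ∈ X.states, map x ∈ Y.states
  map_exec : ∀ γ ∈ X.execPaths, map.comp γ ∈ Y.execPaths

/-- The category of multipointed `d`-spaces. -/
instance : Category MDSpace where
  Hom X Y := Hom X Y
  id X := ⟨ContinuousMap.id _, fun _ h => h, fun _ h => h⟩
  comp f g := ⟨g.map.comp f.map, fun x h => g.map_states _ (f.map_states x h),
    fun γ h => g.map_exec _ (f.map_exec γ h)⟩

/-- The `Δ`-Hausdorff multipointed `d`-spaces: the image of every path in the underlying
(`Δ`-generated) space is closed. -/
def isDeltaHausdorff : ObjectProperty MDSpace := fun X =>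
  ∀ γ : C(unitInterval, X.carrier), IsClosed (Set.range γ)

theorem isDeltaHausdorff_of_t2 (X : MDSpace) [T2Space X.carrier] : isDeltaHausdorff X :=
  fun γ => (isCompact_range γ.continuous).isClosed

end MDSpace

/-- A directed space in the sense of Grandis. -/
structure DirectedSpace : Type 1 where
  carrier : Type
  [top : TopologicalSpace carrier]
  [deltaGenerated : DeltaGeneratedSpace carrier]
  /-- the directed paths -/
  dpaths : Set C(unitInterval, carrier)
  const_mem : ∀ x, ContinuousMap.const unitInterval x ∈ dpaths
  comp_mem : ∀ γ₁ ∈ dpaths, ∀ γ₂ ∈ dpaths, ∀ h : γ₁ 1 = γ₂ 0, normComp γ₁ γ₂ h ∈ dpaths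
  reparam_mem : ∀ γ ∈ dpaths, ∀ φ ∈ reparamI, γ.comp φ ∈ dpaths

attribute [instance] DirectedSpace.top DirectedSpace.deltaGenerated

/-- The set of directed paths from `α` to `β`. -/
def DirectedSpace.pathsFrom (X : DirectedSpace) (α β : X.carrier) :
    Set C(unitInterval, X.carrier) :=
  {γ | γ ∈ X.dpaths ∧ γ 0 = α ∧ γ 1 = β}

namespace MDSpace

/-- The paths of the smallest directed structure that contains the execution paths. -/
inductive GeneratedPath (X : MDSpace) : C(unitInterval, X.carrier) → Prop
  | exec (γ) (h : γ ∈ X.execPaths) : GeneratedPath X γ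
  | const (x) : GeneratedPath X (ContinuousMap.const unitInterval x)
  | comp (γ₁ γ₂) (h₁ : GeneratedPath X γ₁) (h₂ : GeneratedPath X γ₂) (h : γ₁ 1 = γ₂ 0) :
      GeneratedPath X (normComp γ₁ γ₂ h)
  | reparam (γ) (h : GeneratedPath X γ) (φ) (hφ : φ ∈ reparamI) :
      GeneratedPath X (γ.comp φ)

/-- The directed space of a multipointed `d`-space, i.e. the value on `X` of the left adjoint of
`(Y, P) ↦ (Y, Y, P)`: same underlying space, with the directed structure generated by the
execution paths. -/
def Sp (X : MDSpace) : DirectedSpace where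
  carrier := X.carrier
  dpaths := {γ | GeneratedPath X γ}
  const_mem := .const
  comp_mem γ₁ h₁ γ₂ h₂ h := .comp γ₁ γ₂ h₁ h₂ h
  reparam_mem γ h φ hφ := .reparam γ h φ hφ

end MDSpace

theorem deltaGeneratedSpace_of_discrete (S : Type) [TopologicalSpace S] [DiscreteTopology S] :
    DeltaGeneratedSpace S :=
  ⟨continuous_of_discreteTopology⟩

instance deltaGeneratedSpace_unitInterval : DeltaGeneratedSpace unitInterval := by
  have hc : Continuous (fun x : Fin 1 → ℝ => Set.projIcc (0 : ℝ) 1 zero_le_one (x 0)) :=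
    continuous_projIcc.comp (continuous_apply 0)
  have hq : Topology.IsQuotientMap
      (fun x : Fin 1 → ℝ => Set.projIcc (0 : ℝ) 1 zero_le_one (x 0)) :=
    Topology.IsQuotientMap.of_inverse (f := fun (t : unitInterval) (_ : Fin 1) => (t : ℝ))
      (by fun_prop) hc (fun t => by simp)
  exact hq.isGeneratedBy

/-- A set `S` as the multipointed `d`-space `(S, S, ∅)` with the discrete topology. -/
def discreteMD (S : Type) : MDSpace :=
  letI : TopologicalSpace S := ⊥
  haveI : DiscreteTopology S := ⟨rfl⟩
  haveI := deltaGeneratedSpace_of_discrete S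
  { carrier := S
    states := Set.univ
    execPaths := ∅
    source_mem := fun _ h => h.elim
    target_mem := fun _ h => h.elim
    reparam_mem := fun _ h => h.elim
    comp_mem := fun _ h => h.elim }

/-- The map of multipointed `d`-spaces induced by a map of sets. -/
def discreteMap {S T : Type} (f : S → T) : discreteMD S ⟶ discreteMD T where
  map :=
    letI : TopologicalSpace S := ⊥
    letI : TopologicalSpace T := ⊥
    ⟨f, continuous_bot⟩
  map_states _ _ := trivial
  map_exec _ h := h.elim

section Globe

variable (Z : Type) [TopologicalSpace Z]

/-- The disjoint union of `{0, 1}` (as `false`, `true`) and of the product `Z × [0,1]` taken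
in `Δ`-generated spaces, i.e. with the `Δ`-generated topology of the product topology. -/
abbrev PreGlobe : Type := Bool ⊕ DeltaGeneratedSpace.of (Y := Z × unitInterval)

variable {Z} in
/-- The point `(z, t)` of `Z × [0,1]`. -/
def PreGlobe.pt (z : Z) (t : unitInterval) : PreGlobe Z :=
  Sum.inr (Topology.WithGeneratedByTopology.equiv.symm (z, t))

/-- The identifications `(z, 0) = 0` and `(z, 1) = 1`. -/
inductive globeRel : PreGlobe Z → PreGlobe Z → Prop
  | zero (z : Z) : globeRel (PreGlobe.pt z 0) (Sum.inl false)
  | one (z : Z) : globeRel (PreGlobe.pt z 1) (Sum.inl true)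

/-- The underlying space of the topological globe. -/
abbrev GlobeSpace : Type := Quot (globeRel Z)

instance : DeltaGeneratedSpace Bool := deltaGeneratedSpace_of_discrete Bool

instance : DeltaGeneratedSpace (GlobeSpace Z) := inferInstance

namespace GlobeSpace

/-- The state `0`. -/
def zero : GlobeSpace Z := Quot.mk _ (Sum.inl false)

/-- The state `1`. -/
def one : GlobeSpace Z := Quot.mk _ (Sum.inl true)

variable {Z}

/-- The class of the point `(z, t)`. -/
def pt (z : Z) (t : unitInterval) : GlobeSpace Z := Quot.mk _ (PreGlobe.pt z t)

theorem pt_zero (z : Z) : pt z 0 = zero Z := Quot.sound (.zero z)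

theorem pt_one (z : Z) : pt z 1 = one Z := Quot.sound (.one z)

theorem ind {p : GlobeSpace Z → Prop} (h0 : p (zero Z)) (h1 : p (one Z))
    (h : ∀ z t, p (pt z t)) (x : GlobeSpace Z) : p x := by
  rcases x with ⟨(b | y)⟩
  · cases b
    · exact h0
    · exact h1
  · exact h (Topology.WithGeneratedByTopology.equiv y).1
      (Topology.WithGeneratedByTopology.equiv y).2

/-- The universal property of the globe as a quotient. -/
def lift {Y : Type} (y0 y1 : Y) (f : Z → unitInterval → Y) (h0 : ∀ z, f z 0 = y0)
    (h1 : ∀ z, f z 1 = y1) : GlobeSpace Z → Y :=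
  Quot.lift (Sum.elim (fun b => cond b y1 y0)
    (fun y => f (Topology.WithGeneratedByTopology.equiv y).1
      (Topology.WithGeneratedByTopology.equiv y).2)) (by
    rintro _ _ (z | z)
    · exact h0 z
    · exact h1 z)

theorem continuous_lift {Y : Type} [TopologicalSpace Y] (y0 y1 : Y) (f : Z → unitInterval → Y)
    (h0 : ∀ z, f z 0 = y0) (h1 : ∀ z, f z 1 = y1)
    (hf : Continuous fun y : DeltaGeneratedSpace.of (Y := Z × unitInterval) =>
      f (Topology.WithGeneratedByTopology.equiv y).1
        (Topology.WithGeneratedByTopology.equiv y).2) :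
    Continuous (lift y0 y1 f h0 h1) :=
  continuous_quot_lift _ (Continuous.sumElim continuous_of_discreteTopology hf)

/-- The coordinate in `[0,1]`. -/
def height : GlobeSpace Z → unitInterval :=
  lift 0 1 (fun _ t => t) (fun _ => rfl) (fun _ => rfl)

theorem zero_ne_one : zero Z ≠ one Z := fun h =>
  absurd (congrArg height h) (_root_.zero_ne_one : (0 : unitInterval) ≠ 1)

variable (Z) in
theorem continuous_mk_inr : Continuous fun y : DeltaGeneratedSpace.of (Y := Z × unitInterval) =>
    (Quot.mk (globeRel Z) (Sum.inr y) : GlobeSpace Z) :=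
  continuous_quot_mk.comp continuous_inr

/-- The path `δ_z : t ↦ (z, t)`. -/
def delta (z : Z) : C(unitInterval, GlobeSpace Z) where
  toFun t := pt z t
  continuous_toFun := by
    have h : Continuous ((Topology.WithGeneratedByTopology.equiv
        (X := fun n : ℕ => Fin n → ℝ)).symm ∘ (fun t : unitInterval => (z, t))) :=
      (Topology.IsGeneratedBy.equiv_symm_comp_continuous_iff _ _).2 (by fun_prop)
    exact (continuous_mk_inr Z).comp h

/-- The continuous map of globes induced by a continuous map. -/
def map {W : Type} [TopologicalSpace W] (f : C(Z, W)) : C(GlobeSpace Z, GlobeSpace W) where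
  toFun := lift (zero W) (one W) (fun z t => pt (f z) t) (fun z => pt_zero (f z))
    (fun z => pt_one (f z))
  continuous_toFun := by
    apply continuous_lift
    have h : Continuous ((Topology.WithGeneratedByTopology.equiv
        (X := fun n : ℕ => Fin n → ℝ)).symm ∘
        (fun y : DeltaGeneratedSpace.of (Y := Z × unitInterval) =>
          (f (Topology.WithGeneratedByTopology.equiv y).1,
            (Topology.WithGeneratedByTopology.equiv y).2))) :=
      (Topology.IsGeneratedBy.equiv_symm_comp_continuous_iff _ _).2 (by fun_prop)
    exact (continuous_mk_inr W).comp h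

/-- The order relation that every directed path of a globe respects: the height increases strictly
unless the point stays the same. -/
def Before (x y : GlobeSpace Z) : Prop := x = y ∨ height x < height y

theorem Before.trans {x y z : GlobeSpace Z} (h : Before x y) (h' : Before y z) : Before x z := by
  rcases h with rfl | h
  · exact h'
  · rcases h' with rfl | h'
    · exact .inr h
    · exact .inr (h.trans h')

theorem Before.antisymm {x y : GlobeSpace Z} (h : Before x y) (h' : Before y x) : x = y := by
  rcases h with h | h
  · exact h
  · rcases h' with h' | h'
    · exact h'.symm
    · exact (lt_asymm h h').elim

theorem t2Space_of_subset {E : Type} [NormedAddCommGroup E] [NormedSpace ℝ E] (s : Set E) :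
    T2Space (GlobeSpace s) := by
  let e : GlobeSpace s → ℝ × E := lift (0, 0) (1, 0)
    (fun z t => ((t : ℝ), ((t : ℝ) * (1 - t)) • (z : E))) (by simp) (by simp)
  have e0 : e (zero s) = (0, 0) := rfl
  have e1 : e (one s) = (1, 0) := rfl
  have ept : ∀ (z : s) (t : unitInterval),
    e (pt z t) = ((t : ℝ), ((t : ℝ) * (1 - t)) • (z : E)) := fun _ _ => rfl
  have he : Continuous e := by
    apply continuous_lift
    fun_prop
  have h0 : ∀ x, (e x).1 = 0 → x = zero s := by
    refine ind (fun _ => rfl) (fun h => by simp [e1] at h) (fun z t h => ?_)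
    have : t = 0 := Subtype.ext (by simpa [ept] using h)
    rw [this, pt_zero]
  have h1 : ∀ x, (e x).1 = 1 → x = one s := by
    refine ind (fun h => by simp [e0] at h) (fun _ => rfl) (fun z t h => ?_)
    have : t = 1 := Subtype.ext (by simpa [ept] using h)
    rw [this, pt_one]
  refine T2Space.of_injective_continuous (f := e) ?_ he
  intro x
  refine ind (p := fun x => ∀ ⦃y⦄, e x = e y → x = y) ?_ ?_ ?_ x
  · intro y h
    exact (h0 y (by rw [← h, e0])).symm
  · intro y h
    exact (h1 y (by rw [← h, e1])).symm
  · intro z t y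
    refine ind (p := fun y => e (pt z t) = e y → pt z t = y) ?_ ?_ ?_ y
    · intro h
      exact h0 _ (by rw [h, e0])
    · intro h
      exact h1 _ (by rw [h, e1])
    · intro z' t' h
      rw [ept, ept, Prod.mk.injEq] at h
      obtain ⟨ht, hz⟩ := h
      obtain rfl : t = t' := Subtype.ext ht
      by_cases ht0 : t = 0
      · subst ht0; rw [pt_zero, pt_zero]
      by_cases ht1 : t = 1
      · subst ht1; rw [pt_one, pt_one]
      have a0 : (t : ℝ) ≠ 0 := fun h => ht0 (Subtype.ext h)
      have a1 : (1 - t : ℝ) ≠ 0 := fun h => ht1 (Subtype.ext (sub_eq_zero.1 h).symm)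
      have : (z : E) = z' := smul_right_injective E (mul_ne_zero a0 a1) hz
      rw [Subtype.ext this]

end GlobeSpace

open GlobeSpace

theorem delta_comp_zero {Z : Type} [TopologicalSpace Z] (z : Z) {φ : C(unitInterval, unitInterval)}
    (h : φ ∈ reparamM) : (delta z).comp φ 0 = zero Z := by
  rw [ContinuousMap.comp_apply, reparamM_zero h]
  exact pt_zero z

theorem delta_comp_one {Z : Type} [TopologicalSpace Z] (z : Z) {φ : C(unitInterval, unitInterval)}
    (h : φ ∈ reparamM) : (delta z).comp φ 1 = one Z := by
  rw [ContinuousMap.comp_apply, reparamM_one h]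
  exact pt_one z

/-- The topological globe of `Z`. -/
def globe : MDSpace where
  carrier := GlobeSpace Z
  states := {zero Z, one Z}
  execPaths := {γ | ∃ (z : Z) (φ : C(unitInterval, unitInterval)),
    φ ∈ reparamM ∧ γ = (delta z).comp φ}
  source_mem := by
    rintro _ ⟨z, φ, h, rfl⟩
    exact .inl (delta_comp_zero z h)
  target_mem := by
    rintro _ ⟨z, φ, h, rfl⟩
    exact .inr (delta_comp_one z h)
  reparam_mem := by
    rintro _ ⟨z, φ, h, rfl⟩ ψ h'
    exact ⟨z, φ.comp ψ, reparamM_comp h h', rfl⟩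
  comp_mem := by
    rintro _ ⟨z, φ, h, rfl⟩ _ ⟨z', φ', h', rfl⟩ he
    rw [delta_comp_one z h, delta_comp_zero z' h'] at he
    exact (zero_ne_one he.symm).elim

variable {Z} in
/-- The map of globes induced by a continuous map. -/
def globeMap {W : Type} [TopologicalSpace W] (f : C(Z, W)) : globe Z ⟶ globe W where
  map := GlobeSpace.map f
  map_states := by
    rintro _ (rfl | rfl)
    · exact .inl rfl
    · exact .inr rfl
  map_exec := by
    rintro _ ⟨z, φ, h, rfl⟩
    exact ⟨f z, φ, h, rfl⟩

/-- Every directed path of a globe respects `Before`; in particular a globe has no directed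
loops except the constant paths. -/
theorem before_of_generatedPath {γ : C(unitInterval, (globe Z).carrier)}
    (h : (globe Z).GeneratedPath γ) {s t : unitInterval} (hst : s ≤ t) :
    Before (Z := Z) (γ s) (γ t) := by
  induction h generalizing s t with
  | exec γ h =>
    obtain ⟨z, φ, hφ, rfl⟩ := h
    rcases (hφ.1 hst).eq_or_lt with he | hl
    · left
      change delta z (φ s) = delta z (φ t)
      rw [he]
    · exact .inr hl
  | const x => exact .inl rfl
  | comp γ₁ γ₂ _ _ h ih₁ ih₂ =>
    rw [normComp_apply, normComp_apply]
    have hst' : (s : ℝ) ≤ t := hst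
    split_ifs with hs ht ht
    · exact ih₁ (Subtype.mk_le_mk.2 (by linarith))
    · refine (ih₁ unitInterval.le_one').trans ?_
      rw [h]
      exact ih₂ unitInterval.nonneg'
    · exact (hs (hst'.trans ht)).elim
    · exact ih₂ (Subtype.mk_le_mk.2 (by linarith))
  | reparam γ _ φ hφ ih => exact ih (hφ hst)

end Globe

/-- The closed unit disk `Dⁿ` of `ℝⁿ`; `D⁰` is a point. -/
abbrev Disk (n : ℕ) : Type := Metric.closedBall (0 : EuclideanSpace ℝ (Fin n)) 1

/-- The unit sphere `Sⁿ⁻¹` of `ℝⁿ`; it is empty for `n = 0`. -/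
abbrev BdSphere (n : ℕ) : Type := Metric.sphere (0 : EuclideanSpace ℝ (Fin n)) 1

/-- The inclusion of `Sⁿ⁻¹` in `Dⁿ`. -/
def sphereIncl (n : ℕ) : C(BdSphere n, Disk n) :=
  ⟨Set.inclusion Metric.sphere_subset_closedBall, continuous_inclusion _⟩

/-- The inclusion of the globe of `Sⁿ⁻¹` in the globe of `Dⁿ`. -/
def globeIncl (n : ℕ) : globe (BdSphere n) ⟶ globe (Disk n) := globeMap (sphereIncl n)

/-- The set of maps `I^{gl,top}`. -/
def Igl : MorphismProperty MDSpace := MorphismProperty.ofHoms globeIncl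

/-- The map `C : ∅ → {0}`. -/
def mapC : discreteMD Empty ⟶ discreteMD Unit := discreteMap Empty.elim

/-- The map `R : {0, 1} → {0}`. -/
def mapR : discreteMD Bool ⟶ discreteMD Unit := discreteMap (fun _ => ())

/-- The set of maps `I^{gl,top} ∪ {C}`. -/
def IglC : MorphismProperty MDSpace := Igl ⊔ MorphismProperty.single mapC

/-- The set `I^{gl,top} ∪ {C, R}` of generating cofibrations of the q-model structure. -/
def genCof : MorphismProperty MDSpace := IglC ⊔ MorphismProperty.single mapR

/-- An object is cellular (for a class `I` of maps) if the map from the initial object to it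
is a transfinite composition of pushouts of maps of `I`. -/
def IsCellular {C : Type 1} [Category.{0} C] (I : MorphismProperty C) (X : C) : Prop :=
  ∃ (E : C) (hE : Limits.IsInitial E),
    MorphismProperty.transfiniteCompositions.{0} I.pushouts (hE.to X)

/-- The directed paths of the globe of `Dⁿ` between two distinct points of `{0, 1} ∪ F`. -/
def subdivPaths (n : ℕ) (F : Set (GlobeSpace (Disk n))) :
    Set C(unitInterval, GlobeSpace (Disk n)) :=
  {γ | γ ∈ (globe (Disk n)).Sp.dpaths ∧ γ 0 ∈ (globe (Disk n)).states ∪ F ∧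
    γ 1 ∈ (globe (Disk n)).states ∪ F ∧ γ 0 ≠ γ 1}

/-- The globe of `Dⁿ` with the additional set `F` of states: for two distinct states, the
execution paths are the directed paths of the globe of `Dⁿ`, and there is no execution path
from a state to itself. -/
def globeSubdiv (n : ℕ) (F : Set (GlobeSpace (Disk n))) : MDSpace where
  carrier := GlobeSpace (Disk n)
  states := (globe (Disk n)).states ∪ F
  execPaths := subdivPaths n F
  source_mem _ h := h.2.1
  target_mem _ h := h.2.2.1
  reparam_mem γ h φ hφ := by
    refine ⟨(globe (Disk n)).Sp.reparam_mem γ h.1 φ hφ.1, ?_⟩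
    rw [ContinuousMap.comp_apply, ContinuousMap.comp_apply, reparamM_zero hφ, reparamM_one hφ]
    exact h.2
  comp_mem γ₁ h₁ γ₂ h₂ h := by
    refine ⟨(globe (Disk n)).Sp.comp_mem γ₁ h₁.1 γ₂ h₂.1 h, ?_⟩
    rw [normComp_zero, normComp_one]
    refine ⟨h₁.2.1, h₂.2.2.1, fun he => h₁.2.2.2 ?_⟩
    have b₁ := before_of_generatedPath (Disk n) h₁.1 (unitInterval.nonneg' (t := 1))
    have b₂ : GlobeSpace.Before (γ₁ 1) (γ₁ 0) := by
      rw [h, he]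
      exact before_of_generatedPath (Disk n) h₂.1 (unitInterval.nonneg' (t := 1))
    exact b₁.antisymm b₂

/-- The map from the globe of `Dⁿ` to its subdivision given by the identity. -/
def globeToSubdiv (n : ℕ) (F : Set (GlobeSpace (Disk n))) :
    globe (Disk n) ⟶ globeSubdiv n F where
  map := ContinuousMap.id _
  map_states _ h := .inl h
  map_exec := by
    rintro γ ⟨z, φ, h, rfl⟩
    have h0 := delta_comp_zero z h
    have h1 := delta_comp_one z h
    refine ⟨.exec _ ⟨z, φ, h, rfl⟩, .inl (.inl h0), .inl (.inr h1), ?_⟩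
    intro he
    exact GlobeSpace.zero_ne_one (h0.symm.trans (he.trans h1))

/-- The inclusion of the globe of `Sⁿ⁻¹` in the subdivided globe of `Dⁿ`. -/
def subdivIncl (n : ℕ) (F : Set (GlobeSpace (Disk n))) :
    globe (BdSphere n) ⟶ globeSubdiv n F :=
  globeIncl n ≫ globeToSubdiv n F

/-- The category of multipointed `d`-spaces over `Δ`-Hausdorff `Δ`-generated spaces. -/
abbrev MDSpaceH : Type 1 := MDSpace.isDeltaHausdorff.FullSubcategory

/-- The globe of `Sⁿ⁻¹` over `Δ`-Hausdorff spaces. -/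
def globeSphereH (n : ℕ) : MDSpaceH :=
  ⟨globe (BdSphere n),
    haveI : T2Space (globe (BdSphere n)).carrier := GlobeSpace.t2Space_of_subset _
    MDSpace.isDeltaHausdorff_of_t2 _⟩

/-- The subdivided globe of `Dⁿ` over `Δ`-Hausdorff spaces. -/
def globeSubdivH (n : ℕ) (F : Set (GlobeSpace (Disk n))) : MDSpaceH :=
  ⟨globeSubdiv n F,
    haveI : T2Space (globeSubdiv n F).carrier :=
      GlobeSpace.t2Space_of_subset (Metric.closedBall (0 : EuclideanSpace ℝ (Fin n)) 1)
    MDSpace.isDeltaHausdorff_of_t2 _⟩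

/-- The inclusion of the globe of `Sⁿ⁻¹` in the subdivided globe over `Δ`-Hausdorff spaces. -/
def subdivInclH (n : ℕ) (F : Set (GlobeSpace (Disk n))) :
    globeSphereH n ⟶ globeSubdivH n F :=
  ObjectProperty.homMk (subdivIncl n F)

/-- The maps of a class `I` between `Δ`-Hausdorff multipointed `d`-spaces. -/
def restrictH (I : MorphismProperty MDSpace) : MorphismProperty MDSpaceH :=
  I.inverseImage MDSpace.isDeltaHausdorff.ι

/-!
# Subdivided globes are finite relative cell complexes

All the stages of the cell decomposition are realized inside `X = globeSubdiv n F`: a subset `B` of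
its underlying space carries the states of `X` that it contains and the execution paths of `X` whose
image it contains (`MDSpace.sub`). The underlying space is compact Hausdorff, so if `B` is closed
and `g : Q → X` is an injective map from a compact space, then `B ∪ g(Q)` is a quotient of the
disjoint union of `B` and `Q`. It is therefore `Δ`-generated as soon as `B` and `Q` are, and it is
the pushout of `B` and `Q` along `g⁻¹(B)`. On execution paths, the square is a pushout as soon as
every execution path in `B ∪ g(Q)` is obtained from those of `B` and `Q` by normalized composition
and reparametrization (`IsFiniteCellExt.of_attach`). All the spaces involved are Hausdorff, and a
square of `Δ`-Hausdorff objects that is a pushout among all multipointed `d`-spaces is a pushout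
among the `Δ`-Hausdorff ones, so that both choices of the category of spaces are treated at once
(`attachments`).

A directed path of a globe is a nondecreasing path along one line `{z} × [0,1]`
(`mem_dpaths_iff`). Starting from the globe of the sphere, three kinds of cells are attached.

* The states of `F`, by pushouts of `C` (`isFiniteCellExt_insert`).
* For every line through a point of `F`, the segments between consecutive states, by pushouts along
  the globe of `D⁰` (`isFiniteCellExt_segment`, `isFiniteCellExt_fill`). A path that traverses
  such a segment is cut at its ends.
* Cells of the disk `Dⁿ` relative to the sphere and to the finite set `Z` of the interior points
  whose line meets `F`. No new line contains a state other than `0` and `1`, so a cell `Dᵏ → Dⁿ`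
  gives a pushout along `Glob(Sᵏ⁻¹) → Glob(Dᵏ)` (`isFiniteCellExt_hull`). The cells come from an
  induction on the dimension and on the number of points: a convex body is cut by a hyperplane
  through one of its points in `Z` into a slice and two halves, and a convex body without such a
  point is a single cell (`isFiniteCellExt_convex`).

For cellularity the same construction starts from the empty space. The states and the lines that
contain `F` come first, then the sphere, as an iterated union of pairs of hemispheres
(`isFiniteCellExt_sphere`), and then the rest of the disk.
-/

open GlobeSpace Limits Topology Set unitInterval

/-! ### Finite compositions -/

namespace CategoryTheory.MorphismProperty

/-- A finite composition is a transfinite one, indexed by a finite ordinal. -/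
theorem transfiniteCompositions_of_multiplicativeClosure {C : Type 1} [Category.{0} C]
    {W : MorphismProperty C} {X Y : C} {f : X ⟶ Y} (hf : W.multiplicativeClosure f) :
    transfiniteCompositions.{0} W f := by
  rw [multiplicativeClosure_eq_multiplicativeClosure'] at hf
  suffices h : ∃ (n : ℕ) (F : ComposableArrows C n),
      CategoryTheory.Arrow.mk F.hom = CategoryTheory.Arrow.mk f ∧
        ∀ i : Fin n, W (F.map (homOfLE i.castSucc_le_succ)) by
    obtain ⟨n, F, e, hF⟩ := h
    exact transfiniteCompositionsOfShape_le_transfiniteCompositions _ (Fin (n + 1)) _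
      ((TransfiniteCompositionOfShape.ofComposableArrows W F hF).ofArrowIso (eqToIso e)).mem
  induction hf with
  | of f hf => exact ⟨1, .mk₁ f, rfl, fun i => by fin_cases i; assumption⟩
  | id X => exact ⟨0, .mk₀ X, rfl, fun i => i.elim0⟩
  | @of_comp x y z f g hf _ ih =>
    obtain ⟨n, F, e, hF⟩ := ih
    obtain rfl : F.left = y := congrArg (fun a : CategoryTheory.Arrow C => a.left) e
    obtain rfl : F.right = z := congrArg (fun a : CategoryTheory.Arrow C => a.right) e
    obtain rfl : F.hom = g := CategoryTheory.Arrow.mk_injective _ _ e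
    refine ⟨n + 1, F.precomp f, congrArg CategoryTheory.Arrow.mk ?_, Fin.cases hf hF⟩
    cases n with
    | zero => exact ((congrArg (f ≫ ·) (F.map_id 0)).trans (Category.comp_id f)).symm
    | succ n => rfl

/-- A finite composition of maps of `W` need not stay one after composition with isomorphisms when
it has length zero; it does otherwise. -/
theorem multiplicativeClosure_iso_comp_iso {C : Type*} [Category C] {W : MorphismProperty C}
    [W.RespectsIso] {X Y : C} {f : X ⟶ Y} (hf : W.multiplicativeClosure f) (hni : ¬ IsIso f)
    {X' Y' : C} (e : X' ≅ X) (e' : Y ≅ Y') :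
    W.multiplicativeClosure (e.hom ≫ f ≫ e'.hom) := by
  induction hf generalizing Y' with
  | of f hf =>
    exact .of _ (RespectsIso.precomp _ _ _ (RespectsIso.postcomp _ _ _ hf))
  | id X => exact (hni inferInstance).elim
  | @comp_of x y z f g hf hg ih =>
    by_cases hf' : IsIso f
    · refine .of _ (RespectsIso.precomp _ _ _ (RespectsIso.postcomp _ _ _
        (RespectsIso.precomp _ _ _ hg)))
    · have := multiplicativeClosure.comp_of _ _ (ih hf' e (Iso.refl _))
        (RespectsIso.postcomp W e'.hom _ hg)
      simpa using this

end CategoryTheory.MorphismProperty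

/-! ### Pushouts and isomorphisms of multipointed `d`-spaces -/

namespace MDSpace

theorem hom_apply_eq {X Y : MDSpace} {f g : X ⟶ Y} (h : f = g) (x : X.carrier) :
    f.map x = g.map x := by rw [h]

/-- A criterion for a square to be a pushout: the underlying square is one of sets and of spaces,
every state comes from a state, and the execution paths are generated under normalized composition
and reparametrization by those which come from the two corners. -/
theorem isPushout_of_isQuotientMap {P X Q Y : MDSpace} {f : P ⟶ X} {i : P ⟶ Q} {j : X ⟶ Y}
    {g : Q ⟶ Y} (w : f ≫ j = i ≫ g) (hq : IsQuotientMap (Sum.elim j.map g.map))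
    (hj : Function.Injective j.map) (hg : Function.Injective g.map)
    (hjg : ∀ x q, j.map x = g.map q → ∃ p, f.map p = x ∧ i.map p = q)
    (hstates : ∀ y ∈ Y.states, (∃ x ∈ X.states, j.map x = y) ∨ ∃ q ∈ Q.states, g.map q = y)
    (hexec : ∀ E : Set C(I, Y.carrier), (∀ γ ∈ X.execPaths, j.map.comp γ ∈ E) →
      (∀ γ ∈ Q.execPaths, g.map.comp γ ∈ E) → (∀ γ ∈ E, ∀ φ ∈ reparamM, γ.comp φ ∈ E) →
      (∀ γ₁ ∈ E, ∀ γ₂ ∈ E, ∀ h : γ₁ 1 = γ₂ 0, normComp γ₁ γ₂ h ∈ E) → Y.execPaths ⊆ E) :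
    IsPushout f i j g := by
  have key (s : PushoutCocone f i) : ∃ d : Y ⟶ s.pt, j ≫ d = s.inl ∧ g ≫ d = s.inr := by
    let k : C(X.carrier ⊕ Q.carrier, s.pt.carrier) :=
      ⟨Sum.elim s.inl.map s.inr.map, s.inl.map.continuous.sumElim s.inr.map.continuous⟩
    let π : C(X.carrier ⊕ Q.carrier, Y.carrier) := ⟨Sum.elim j.map g.map, hq.continuous⟩
    have hxq : ∀ x q, j.map x = g.map q → s.inl.map x = s.inr.map q := by
      intro x q h
      obtain ⟨p, rfl, rfl⟩ := hjg x q h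
      exact hom_apply_eq s.condition p
    have hπ : IsQuotientMap π := hq
    have hk : Function.FactorsThrough k π := by
      rintro (x | x) (y | y) h
      · exact congrArg s.inl.map (hj h)
      · exact hxq x y h
      · exact (hxq y x h.symm).symm
      · exact congrArg s.inr.map (hg h)
    let d : C(Y.carrier, s.pt.carrier) := hπ.lift k hk
    have hd : d.comp π = k := hπ.lift_comp k hk
    have hdj : d.comp j.map = s.inl.map := by
      ext x; exact DFunLike.congr_fun hd (Sum.inl x)
    have hdg : d.comp g.map = s.inr.map := by
      ext x; exact DFunLike.congr_fun hd (Sum.inr x)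
    refine ⟨⟨d, ?_, ?_⟩, Hom.ext hdj, Hom.ext hdg⟩
    · intro y hy
      rcases hstates y hy with ⟨x, hx, rfl⟩ | ⟨q, hx, rfl⟩
      · have : d (j.map x) = s.inl.map x := DFunLike.congr_fun hdj x
        rw [this]; exact s.inl.map_states x hx
      · have : d (g.map q) = s.inr.map q := DFunLike.congr_fun hdg q
        rw [this]; exact s.inr.map_states q hx
    · refine hexec {γ | d.comp γ ∈ s.pt.execPaths} ?_ ?_ ?_ ?_
      · intro γ hγ
        have : d.comp (j.map.comp γ) = s.inl.map.comp γ := by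
          rw [← ContinuousMap.comp_assoc, hdj]
        change _ ∈ s.pt.execPaths
        rw [this]
        exact s.inl.map_exec γ hγ
      · intro γ hγ
        have : d.comp (g.map.comp γ) = s.inr.map.comp γ := by
          rw [← ContinuousMap.comp_assoc, hdg]
        change _ ∈ s.pt.execPaths
        rw [this]
        exact s.inr.map_exec γ hγ
      · intro γ hγ φ hφ
        exact s.pt.reparam_mem _ hγ φ hφ
      · intro γ₁ h₁ γ₂ h₂ h
        change _ ∈ s.pt.execPaths
        rw [comp_normComp]
        exact s.pt.comp_mem _ h₁ _ h₂ _
  choose d hdj hdg using key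
  refine ⟨⟨w⟩, ⟨PushoutCocone.IsColimit.mk w d hdj hdg ?_⟩⟩
  intro s m hm hm'
  refine Hom.ext (ContinuousMap.ext fun y => ?_)
  obtain ⟨x | q, rfl⟩ := hq.surjective y
  · exact hom_apply_eq (hm.trans (hdj s).symm) x
  · exact hom_apply_eq (hm'.trans (hdg s).symm) q

/-- The isomorphism given by a homeomorphism which identifies states and execution paths. -/
def isoOfHomeomorph {X Y : MDSpace} (f : X ⟶ Y) (e : X.carrier ≃ₜ Y.carrier)
    (he : ∀ x, e x = f.map x) (hs : ∀ x, f.map x ∈ Y.states → x ∈ X.states)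
    (hp : ∀ γ, f.map.comp γ ∈ Y.execPaths → γ ∈ X.execPaths) : X ≅ Y where
  hom := f
  inv :=
    { map := e.symm
      map_states := fun y hy => hs _ (by
        have : f.map (e.symm y) = y := by rw [← he, e.apply_symm_apply]
        exact this.symm ▸ hy)
      map_exec := fun γ hγ => hp _ (by
        have : f.map.comp ((e.symm : C(Y.carrier, X.carrier)).comp γ) = γ := by
          ext t; exact (he _).symm.trans (e.apply_symm_apply _)
        exact this.symm ▸ hγ) }
  hom_inv_id := Hom.ext (ContinuousMap.ext fun x =>
    (congrArg e.symm (he x)).symm.trans (e.symm_apply_apply x))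
  inv_hom_id := Hom.ext (ContinuousMap.ext fun x =>
    (he _).symm.trans (e.apply_symm_apply x))

/-! ### Finite cell attachments inside a fixed multipointed `d`-space -/

variable (X : MDSpace)

/-- The inclusion of a subset, as a continuous map. -/
def val (B : Set X.carrier) : C(B, X.carrier) := ⟨Subtype.val, continuous_subtype_val⟩

/-- The subset `B` of `X` with the induced topology, with the states of `X` which lie in `B` and
the execution paths of `X` whose image is contained in `B`. -/
def sub (B : Set X.carrier) (hB : DeltaGeneratedSpace B) : MDSpace where
  carrier := B
  states := {x | x.1 ∈ X.states}
  execPaths := {γ | (X.val B).comp γ ∈ X.execPaths}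
  source_mem γ h := X.source_mem _ h
  target_mem γ h := X.target_mem _ h
  reparam_mem γ h φ hφ := X.reparam_mem _ h φ hφ
  comp_mem γ₁ h₁ γ₂ h₂ h := by
    change _ ∈ X.execPaths
    rw [comp_normComp]
    exact X.comp_mem _ h₁ _ h₂ _

/-- `MDSpace.sub` as a `Δ`-Hausdorff multipointed `d`-space, for a Hausdorff ambient space. -/
def subH [T2Space X.carrier] (B : Set X.carrier) (hB : DeltaGeneratedSpace B) : MDSpaceH :=
  ⟨X.sub B hB, haveI : T2Space (X.sub B hB).carrier := inferInstanceAs (T2Space B)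
    isDeltaHausdorff_of_t2 _⟩

variable {X} in
/-- The inclusion between two subsets of `X`. -/
def subIncl [T2Space X.carrier] {B B' : Set X.carrier} (hB : DeltaGeneratedSpace B)
    (hB' : DeltaGeneratedSpace B') (h : B ⊆ B') : X.subH B hB ⟶ X.subH B' hB' :=
  ObjectProperty.homMk
    { map := ⟨inclusion h, continuous_inclusion h⟩
      map_states := fun _ hx => hx
      map_exec := fun _ hγ => hγ }

end MDSpace

open MDSpace

/-- The maps of `Δ`-Hausdorff multipointed `d`-spaces which are, in the category of all
multipointed `d`-spaces, pushouts of a map of `I^{gl,top} ∪ {C}` along a map between `Δ`-Hausdorff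
objects. Such a map is then a pushout in both categories. -/
def attachments : MorphismProperty MDSpaceH := fun A B f =>
  ∃ (P Q : MDSpaceH) (i : P ⟶ Q) (t : P ⟶ A) (b : Q ⟶ B),
    IglC i.hom ∧ IsPushout t.hom i.hom f.hom b.hom

theorem attachments_le_pushouts : attachments ≤ (restrictH IglC).pushouts := by
  rintro A B f ⟨P, Q, i, t, b, hi, h⟩
  have : IsPushout t i f b := IsPushout.of_map MDSpace.isDeltaHausdorff.ι
    (ObjectProperty.hom_ext _ h.w) h
  exact MorphismProperty.pushouts_mk _ this hi

theorem attachments_le_inverseImage :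
    attachments ≤ IglC.pushouts.inverseImage MDSpace.isDeltaHausdorff.ι := by
  rintro A B f ⟨P, Q, i, t, b, hi, h⟩
  exact MorphismProperty.pushouts_mk _ h hi

instance : attachments.RespectsIso := by
  refine MorphismProperty.RespectsIso.mk _ ?_ ?_
  · rintro A A' B e f ⟨P, Q, i, t, b, hi, h⟩
    refine ⟨P, Q, i, t ≫ e.inv, b ≫ 𝟙 B, hi, ?_⟩
    exact h.paste_horiz (IsPushout.of_horiz_isIso ⟨by simp⟩)
  · rintro A B B' e f ⟨P, Q, i, t, b, hi, h⟩
    refine ⟨P, Q, i, t ≫ 𝟙 A, b ≫ e.hom, hi, ?_⟩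
    exact h.paste_horiz (IsPushout.of_horiz_isIso ⟨by simp⟩)

theorem multiplicativeClosure_pushouts_of_attachments {A B : MDSpaceH} {f : A ⟶ B}
    (hf : attachments.multiplicativeClosure f) : IglC.pushouts.multiplicativeClosure f.hom := by
  induction hf with
  | of f hf => exact .of _ (attachments_le_inverseImage _ hf)
  | id X => exact .id _
  | comp_of f g _ hg ih => exact .comp_of _ _ ih (attachments_le_inverseImage _ hg)

/-- `B'` is obtained from `B` by attaching finitely many cells inside `X`. The topology of closed
subspaces of a `Δ`-generated space need not be `Δ`-generated; that it is so here is carried along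
the attachments. -/
def IsFiniteCellExt (X : MDSpace) [T2Space X.carrier] (B B' : Set X.carrier) : Prop :=
  ∃ h : B ⊆ B', ∀ hB : DeltaGeneratedSpace B, IsClosed B → IsClosed B' ∧
    ∃ hB' : DeltaGeneratedSpace B', attachments.multiplicativeClosure (subIncl hB hB' h)

namespace IsFiniteCellExt

variable {X : MDSpace} [T2Space X.carrier]

theorem refl (B : Set X.carrier) : IsFiniteCellExt X B B :=
  ⟨subset_rfl, fun hB hc => ⟨hc, hB, .id _⟩⟩

theorem trans {B B' B'' : Set X.carrier} (h : IsFiniteCellExt X B B')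
    (h' : IsFiniteCellExt X B' B'') : IsFiniteCellExt X B B'' := by
  obtain ⟨s, h⟩ := h
  obtain ⟨s', h'⟩ := h'
  refine ⟨s.trans s', fun hB hc => ?_⟩
  obtain ⟨hc', hB', h⟩ := h hB hc
  obtain ⟨hc'', hB'', h'⟩ := h' hB' hc'
  exact ⟨hc'', hB'', attachments.multiplicativeClosure.comp_mem _ _ h h'⟩

/-- Attaching one cell `i : P ⟶ Q` along an injective map `g` from `Q` to `X`. -/
theorem of_attach [CompactSpace X.carrier] {P Q : MDSpaceH} (i : P ⟶ Q) (hi : IglC i.hom)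
    [CompactSpace Q.obj.carrier] (g : C(Q.obj.carrier, X.carrier)) (hg : Function.Injective g)
    {B B' : Set X.carrier} (hB' : B' = B ∪ range g)
    (hgB : ∀ q, g q ∈ B ↔ q ∈ range i.hom.map)
    (hgs : ∀ q ∈ Q.obj.states, g q ∈ X.states)
    (hs : ∀ q, g q ∈ X.states → g q ∈ B ∨ q ∈ Q.obj.states)
    (hge : ∀ γ ∈ Q.obj.execPaths, g.comp γ ∈ X.execPaths)
    (he : ∀ E : Set C(I, X.carrier),
      (∀ γ ∈ X.execPaths, range γ ⊆ B → γ ∈ E) → (∀ γ ∈ Q.obj.execPaths, g.comp γ ∈ E) →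
      (∀ γ ∈ E, ∀ φ ∈ reparamM, γ.comp φ ∈ E) →
      (∀ γ₁ ∈ E, ∀ γ₂ ∈ E, ∀ h : γ₁ 1 = γ₂ 0, normComp γ₁ γ₂ h ∈ E) →
      ∀ γ ∈ X.execPaths, range γ ⊆ B' → γ ∈ E) :
    IsFiniteCellExt X B B' := by
  subst hB'
  refine ⟨subset_union_left, fun hB hc => ?_⟩
  have hc' : IsClosed (B ∪ range g) := hc.union (isCompact_range g.continuous).isClosed
  let gB : C(Q.obj.carrier, ↥(B ∪ range g)) :=
    ⟨fun q => ⟨g q, .inr ⟨q, rfl⟩⟩, by fun_prop⟩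
  have : CompactSpace B := isCompact_iff_compactSpace.1 hc.isCompact
  have hq : IsQuotientMap (Sum.elim (inclusion (subset_union_left (s := B) (t := range g))) gB) := by
    refine .of_surjective_continuous ?_
      ((continuous_inclusion subset_union_left).sumElim gB.continuous)
    rintro ⟨x, hx | ⟨q, rfl⟩⟩
    · exact ⟨.inl ⟨x, hx⟩, rfl⟩
    · exact ⟨.inr q, rfl⟩
  have hB' : DeltaGeneratedSpace ↥(B ∪ range g) := hq.isGeneratedBy
  refine ⟨hc', hB', .of _ ⟨P, Q, i, ?_, ?_, hi, ?_⟩⟩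
  · exact ObjectProperty.homMk
      { map := ⟨fun p => ⟨g (i.hom.map p), (hgB _).2 ⟨p, rfl⟩⟩, by fun_prop⟩
        map_states := fun p hp => hgs _ (i.hom.map_states p hp)
        map_exec := fun γ hγ => hge _ (i.hom.map_exec γ hγ) }
  · exact ObjectProperty.homMk
      { map := gB
        map_states := fun p hp => hgs _ hp
        map_exec := fun γ hγ => hge _ hγ }
  · refine isPushout_of_isQuotientMap rfl hq (inclusion_injective subset_union_left) ?_ ?_ ?_ ?_
    · intro q q' h
      exact hg (congrArg Subtype.val h)
    · intro x q h
      have h' : x.1 = g q := congrArg Subtype.val h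
      obtain ⟨p, rfl⟩ := (hgB q).1 (h' ▸ x.2)
      exact ⟨p, Subtype.ext h'.symm, rfl⟩
    · rintro ⟨y, hy⟩ hy'
      by_cases hyB : y ∈ B
      · exact .inl ⟨⟨y, hyB⟩, hy', rfl⟩
      · obtain ⟨q, rfl⟩ := hy.resolve_left hyB
        exact .inr ⟨q, (hs q hy').resolve_left hyB, rfl⟩
    · intro E hE₁ hE₂ hE₃ hE₄ γ hγ
      suffices h : (X.val (B ∪ range g)).comp γ ∈
          {δ | ∃ δ' ∈ E, (X.val (B ∪ range g)).comp δ' = δ} by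
        obtain ⟨γ', hγ', h⟩ := h
        have : γ' = γ := ContinuousMap.ext fun t => Subtype.ext (DFunLike.congr_fun h t)
        exact this ▸ hγ'
      refine he _ ?_ ?_ ?_ ?_ _ hγ (by rintro _ ⟨t, rfl⟩; exact (γ t).2)
      · intro δ hδ hδB
        let δ' : C(I, B) := ⟨fun t => ⟨δ t, hδB ⟨t, rfl⟩⟩, by fun_prop⟩
        exact ⟨_, hE₁ δ' hδ, rfl⟩
      · intro δ hδ
        exact ⟨_, hE₂ δ hδ, rfl⟩
      · rintro _ ⟨δ, hδ, rfl⟩ φ hφ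
        exact ⟨_, hE₃ δ hδ φ hφ, rfl⟩
      · rintro _ ⟨δ₁, h₁, rfl⟩ _ ⟨δ₂, h₂, rfl⟩ h
        exact ⟨_, hE₄ δ₁ h₁ δ₂ h₂ (Subtype.ext h), comp_normComp _ _ _ _⟩

end IsFiniteCellExt

/-! ### Points and compactness of globes -/

namespace GlobeSpace

variable {Z : Type} [TopologicalSpace Z]

theorem continuous_height : Continuous (height (Z := Z)) :=
  continuous_lift _ _ _ _ _ (by fun_prop)

theorem pt_eq_pt_iff {z z' : Z} {t t' : I} :
    pt z t = pt z' t' ↔ t = t' ∧ (t = 0 ∨ t = 1 ∨ z = z') := by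
  constructor
  · intro h
    obtain rfl : t = t' := congrArg height h
    refine ⟨rfl, ?_⟩
    by_contra! hc
    classical
    -- `f` recovers the line of a point other than `0` and `1`
    let f : GlobeSpace Z → Option Z :=
      lift none none (fun z t => if t = 0 ∨ t = 1 then none else some z) (by simp) (by simp)
    have hf : ∀ z t, f (pt z t) = if t = 0 ∨ t = 1 then none else some z := fun _ _ => rfl
    have := congrArg f h
    simp [hf, hc] at this
  · rintro ⟨rfl, rfl | rfl | rfl⟩
    · rw [pt_zero, pt_zero]
    · rw [pt_one, pt_one]
    · rfl

theorem exists_pt [Nonempty Z] (x : GlobeSpace Z) : ∃ z t, x = pt z t := by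
  obtain ⟨z₀⟩ := ‹Nonempty Z›
  induction x using GlobeSpace.ind with
  | h0 => exact ⟨z₀, 0, (pt_zero _).symm⟩
  | h1 => exact ⟨z₀, 1, (pt_one _).symm⟩
  | h z t => exact ⟨z, t, rfl⟩

theorem height_map {W : Type} [TopologicalSpace W] (f : C(Z, W)) (x : GlobeSpace Z) :
    height (map f x) = height x := by
  induction x using GlobeSpace.ind <;> rfl

theorem map_pt {W : Type} [TopologicalSpace W] (f : C(Z, W)) (z : Z) (t : I) :
    map f (pt z t) = pt (f z) t := rfl

theorem eq_zero_of_height {x : GlobeSpace Z} (h : height x = 0) : x = zero Z := by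
  induction x using GlobeSpace.ind with
  | h0 => rfl
  | h1 => exact (_root_.zero_ne_one (Eq.symm h : (0 : I) = 1)).elim
  | h z t => rw [show t = 0 from h, pt_zero]

theorem eq_one_of_height {x : GlobeSpace Z} (h : height x = 1) : x = one Z := by
  induction x using GlobeSpace.ind with
  | h0 => exact (_root_.zero_ne_one (h : (0 : I) = 1)).elim
  | h1 => rfl
  | h z t => rw [show t = 1 from h, pt_one]

theorem map_injective {W : Type} [TopologicalSpace W] {f : C(Z, W)} (hf : Function.Injective f) :
    Function.Injective (map f) := by
  intro x y h
  have hh : height x = height y := by rw [← height_map f x, h, height_map]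
  induction x using GlobeSpace.ind with
  | h0 => exact (eq_zero_of_height hh.symm).symm
  | h1 => exact (eq_one_of_height hh.symm).symm
  | h z t =>
    induction y using GlobeSpace.ind with
    | h0 => exact eq_zero_of_height hh
    | h1 => exact eq_one_of_height hh
    | h z' t' =>
      rw [map_pt, map_pt, pt_eq_pt_iff] at h
      exact pt_eq_pt_iff.2 ⟨h.1, h.2.imp_right (Or.imp_right fun e => hf e)⟩

instance [CompactSpace Z] [DeltaGeneratedSpace (Z × I)] : CompactSpace (GlobeSpace Z) :=
  haveI : CompactSpace (DeltaGeneratedSpace.of (Y := Z × I)) :=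
    (IsGeneratedBy.homeomorph (X := fun n : ℕ => Fin n → ℝ) (Y := Z × I)).symm.compactSpace
  inferInstance

end GlobeSpace

theorem deltaGeneratedSpace_of_finiteDimensional (E : Type) [NormedAddCommGroup E]
    [NormedSpace ℝ E] [FiniteDimensional ℝ E] : DeltaGeneratedSpace E := by
  have e : (Fin (Module.finrank ℝ E) → ℝ) ≃L[ℝ] E :=
    ContinuousLinearEquiv.ofFinrankEq (by simp)
  exact e.toHomeomorph.isQuotientMap.isGeneratedBy

/-- The product of the unit ball with `[0,1]` is a retract of a finite dimensional vector space, so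
its product topology is `Δ`-generated. -/
instance deltaGeneratedSpace_closedBall_prod (E : Type) [NormedAddCommGroup E]
    [NormedSpace ℝ E] [FiniteDimensional ℝ E] :
    DeltaGeneratedSpace (Metric.closedBall (0 : E) 1 × I) := by
  have := deltaGeneratedSpace_of_finiteDimensional (E × ℝ)
  have hmem : ∀ x : E, (max 1 ‖x‖)⁻¹ • x ∈ Metric.closedBall (0 : E) 1 := by
    intro x
    have h1 : 0 < max 1 ‖x‖ := zero_lt_one.trans_le (le_max_left _ _)
    rw [mem_closedBall_zero_iff, norm_smul, norm_inv, Real.norm_of_nonneg h1.le, inv_mul_le_one₀ h1]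
    exact le_max_right _ _
  let r : E × ℝ → Metric.closedBall (0 : E) 1 × I := fun p =>
    (⟨(max 1 ‖p.1‖)⁻¹ • p.1, hmem p.1⟩, projIcc 0 1 zero_le_one p.2)
  have hr : Continuous r := by
    refine Continuous.prodMk (Continuous.subtype_mk ?_ _) (continuous_projIcc.comp continuous_snd)
    refine Continuous.smul (Continuous.inv₀ (by fun_prop) fun p => ?_) continuous_fst
    exact (zero_lt_one.trans_le (le_max_left _ _)).ne'
  have hq : IsQuotientMap r := by
    refine IsQuotientMap.of_inverse (f := fun p => ((p.1 : E), (p.2 : ℝ))) (by fun_prop) hr ?_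
    rintro ⟨⟨x, hx⟩, t⟩
    have hx' : max 1 ‖x‖ = 1 := max_eq_left (mem_closedBall_zero_iff.1 hx)
    ext
    · simp [r, hx']
    · simp [r]
  exact hq.isGeneratedBy

instance (E : Type) [NormedAddCommGroup E] [NormedSpace ℝ E] [FiniteDimensional ℝ E] :
    CompactSpace (GlobeSpace (Metric.closedBall (0 : E) 1)) :=
  haveI : CompactSpace (Metric.closedBall (0 : E) 1) :=
    isCompact_iff_compactSpace.1 (isCompact_closedBall _ _)
  inferInstance

/-! ### Directed paths of a globe -/

/-- The affine path from `u` to `v` in `[0,1]`. -/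
noncomputable def affPath (u v : I) : C(I, I) where
  toFun t := ⟨(1 - t) * u + t * v, (convex_Icc (0 : ℝ) 1) u.2 v.2 (by linarith [t.2.2]) t.2.1
    (by ring)⟩
  continuous_toFun := by fun_prop

theorem coe_affPath (u v t : I) : (affPath u v t : ℝ) = (1 - t) * u + t * v := rfl

theorem affPath_zero (u v : I) : affPath u v 0 = u := by
  ext; simp [coe_affPath]

theorem affPath_one (u v : I) : affPath u v 1 = v := by
  ext; simp [coe_affPath]

theorem affPath_strictMono {u v : I} (h : u < v) : StrictMono (affPath u v) := by
  intro s t hst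
  have h' : (u : ℝ) < v := h
  have hst' : (s : ℝ) < t := hst
  rw [← Subtype.coe_lt_coe, coe_affPath, coe_affPath]
  nlinarith

theorem affPath_monotone {u v : I} (h : u ≤ v) : Monotone (affPath u v) := by
  rcases h.eq_or_lt with rfl | h
  · intro s t _
    rw [← Subtype.coe_le_coe, coe_affPath, coe_affPath]
    exact le_of_eq (by ring)
  · exact (affPath_strictMono h).monotone

theorem mem_reparamM {φ : C(I, I)} (h : Monotone φ) (h0 : φ 0 = 0) (h1 : φ 1 = 1) :
    φ ∈ reparamM :=
  ⟨h, fun y => by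
    have := intermediate_value_univ (0 : I) 1 φ.continuous
    rw [h0, h1] at this
    exact this ⟨y.2.1, y.2.2⟩⟩

/-- A nondecreasing path from `u` to `v` is the affine one up to reparametrization. -/
theorem exists_eq_affPath_comp {u v : I} (h : u < v) {φ : C(I, I)} (hφ : Monotone φ)
    (h0 : φ 0 = u) (h1 : φ 1 = v) : ∃ ψ ∈ reparamM, φ = (affPath u v).comp ψ := by
  have h' : (0 : ℝ) < v - u := sub_pos.2 h
  have hu : ∀ t, (u : ℝ) ≤ φ t := fun t => h0 ▸ hφ t.2.1
  have hv : ∀ t, (φ t : ℝ) ≤ v := fun t => h1 ▸ hφ t.2.2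
  let ψ : C(I, I) := ⟨fun t => ⟨(φ t - u) / (v - u), div_nonneg (sub_nonneg.2 (hu t)) h'.le,
    (div_le_one h').2 (sub_le_sub_right (hv t) _)⟩, by fun_prop⟩
  have hψ : ∀ t, (ψ t : ℝ) = (φ t - u) / (v - u) := fun _ => rfl
  refine ⟨ψ, mem_reparamM ?_ ?_ ?_, ?_⟩
  · intro s t hst
    have : (φ s : ℝ) ≤ φ t := hφ hst
    rw [← Subtype.coe_le_coe, hψ, hψ]
    gcongr
  · ext; simp [hψ, h0]
  · ext; simp [hψ, h1, h'.ne']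
  · ext t
    simp only [ContinuousMap.comp_apply, coe_affPath, hψ]
    field_simp
    ring

/-- A path is, up to reparametrization, the composite of its restrictions to `[0,u]` and
`[u,1]`. -/
theorem exists_eq_normComp_comp {X : Type} [TopologicalSpace X] (γ : C(I, X)) {u : I}
    (h0 : 0 < u) (h1 : u < 1) : ∃ ψ ∈ reparamM, ∃ h,
      γ = (normComp (γ.comp (affPath 0 u)) (γ.comp (affPath u 1)) h).comp ψ := by
  have h0' : (0 : ℝ) < u := h0
  have h1' : (0 : ℝ) < 1 - u := sub_pos.2 h1
  have hc : affPath 0 u 1 = affPath u 1 0 := by rw [affPath_one, affPath_zero]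
  -- the inverse of the composite of the affine paths from `0` to `u` and from `u` to `1`
  let f : I → ℝ := fun s => min ((s : ℝ) / u) 1 / 2 + max ((s : ℝ) - u) 0 / (2 * (1 - u))
  have f1 : ∀ s : I, (s : ℝ) ≤ u → f s = s / u / 2 := fun s hs => by
    simp only [f]
    rw [min_eq_left ((div_le_one h0').2 hs), max_eq_right (by linarith)]
    simp
  have f2 : ∀ s : I, (u : ℝ) ≤ s → f s = 1 / 2 + (s - u) / (2 * (1 - u)) := fun s hs => by
    simp only [f]
    rw [min_eq_right ((one_le_div h0').2 hs), max_eq_left (by linarith)]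
  have fm : Monotone f := by
    intro s t hst
    have : (s : ℝ) ≤ t := hst
    simp only [f]
    gcongr
  have z0 : f 0 = 0 := by rw [f1 _ h0.le]; simp
  have z1 : f 1 = 1 := by rw [f2 _ h1.le]; simp; field_simp; norm_num
  have hfm : ∀ s, f s ∈ I := fun s => ⟨z0 ▸ fm s.2.1, z1 ▸ fm s.2.2⟩
  have fc : Continuous f := by simp only [f]; fun_prop
  let ψ : C(I, I) := ⟨fun s => ⟨f s, hfm s⟩, by fun_prop⟩
  refine ⟨ψ, mem_reparamM (fun s t h => fm h) (Subtype.ext z0) (Subtype.ext z1),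
    congrArg γ hc, ?_⟩
  have key : (normComp (affPath 0 u) (affPath u 1) hc).comp ψ = ContinuousMap.id I := by
    ext s
    rw [ContinuousMap.comp_apply, normComp_apply]
    rcases le_or_gt (s : ℝ) u with hs | hs
    · have hf : ((ψ s : I) : ℝ) = s / u / 2 := f1 s hs
      have : s / u ≤ (1 : ℝ) := (div_le_one h0').2 hs
      rw [dif_pos (by rw [hf]; linarith), coe_affPath]
      simp only [hf]
      simp
      field_simp
    · have hf : ((ψ s : I) : ℝ) = 1 / 2 + (s - u) / (2 * (1 - u)) := f2 s hs.le
      have : (0 : ℝ) < (s - u) / (2 * (1 - u)) := div_pos (sub_pos.2 hs) (by linarith)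
      rw [dif_neg (by rw [hf]; linarith), coe_affPath]
      simp only [hf]
      simp
      field_simp
      ring
  rw [← comp_normComp γ _ _ hc, ContinuousMap.comp_assoc, key, ContinuousMap.comp_id]

theorem exists_unitInterval_apply_eq {φ : C(I, I)} {c : I} (h0 : φ 0 ≤ c) (h1 : c ≤ φ 1) :
    ∃ u, φ u = c :=
  intermediate_value_univ (0 : I) 1 φ.continuous ⟨h0, h1⟩

/-- The directed paths of a globe are the nondecreasing paths along one of its lines. -/
theorem mem_dpaths_iff {Z : Type} [TopologicalSpace Z] [Nonempty Z] {γ : C(I, (globe Z).carrier)} :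
    γ ∈ (globe Z).Sp.dpaths ↔ ∃ (z : Z) (φ : C(I, I)), Monotone φ ∧ γ = (delta z).comp φ := by
  constructor
  · intro h
    suffices h' : ∃ (z : Z) (φ : C(I, I)), γ = (delta z).comp φ by
      obtain ⟨z, φ, rfl⟩ := h'
      refine ⟨z, φ, fun s t hst => ?_, rfl⟩
      rcases before_of_generatedPath Z h hst with he | hl
      · exact (congrArg height he : _).le
      · exact le_of_lt hl
    change (globe Z).GeneratedPath γ at h
    induction h with
    | exec γ h =>
      obtain ⟨z, φ, _, rfl⟩ := h
      exact ⟨z, φ, rfl⟩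
    | const x =>
      obtain ⟨z, t, rfl⟩ := exists_pt (Z := Z) x
      exact ⟨z, .const I t, rfl⟩
    | reparam γ _ φ _ ih =>
      obtain ⟨z, ψ, rfl⟩ := ih
      exact ⟨z, ψ.comp φ, rfl⟩
    | comp γ₁ γ₂ h₁ h₂ h ih₁ ih₂ =>
      obtain ⟨z₁, φ₁, rfl⟩ := ih₁
      obtain ⟨z₂, φ₂, rfl⟩ := ih₂
      have m₁ : ∀ s, φ₁ s ≤ φ₁ 1 := fun s => by
        rcases before_of_generatedPath Z h₁ (le_one' (t := s)) with he | hl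
        · exact (congrArg height he : _).le
        · exact le_of_lt hl
      have m₂ : ∀ s, φ₂ 0 ≤ φ₂ s := fun s => by
        rcases before_of_generatedPath Z h₂ (nonneg' (t := s)) with he | hl
        · exact (congrArg height he : _).le
        · exact le_of_lt hl
      obtain ⟨he, h'⟩ := pt_eq_pt_iff.1 (h : pt z₁ (φ₁ 1) = pt z₂ (φ₂ 0))
      -- two different lines meet only at `0` and `1`, where one of the two paths is constant
      suffices hz : (delta z₁).comp φ₁ = (delta z₂).comp φ₁ ∨
          (delta z₂).comp φ₂ = (delta z₁).comp φ₂ by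
        rcases hz with hz | hz
        · refine ⟨z₂, normComp φ₁ φ₂ he, ?_⟩
          rw [comp_normComp]
          congr 1
        · refine ⟨z₁, normComp φ₁ φ₂ he, ?_⟩
          rw [comp_normComp]
          congr 1
      rcases h' with h' | h' | rfl
      · left
        ext s
        exact pt_eq_pt_iff.2 ⟨rfl, .inl (le_antisymm (h' ▸ m₁ s) nonneg')⟩
      · right
        ext s
        exact pt_eq_pt_iff.2 ⟨rfl, .inr (.inl (le_antisymm le_one' (h' ▸ he ▸ m₂ s)))⟩
      · exact .inl rfl
  · rintro ⟨z, φ, hφ, rfl⟩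
    exact GeneratedPath.reparam (X := globe Z) _ (.exec (X := globe Z) (delta z)
      ⟨z, ContinuousMap.id _, ⟨monotone_id, Function.surjective_id⟩, rfl⟩) φ hφ

/-! ### Attaching the three kinds of cells to subspaces of the subdivided globe -/

/-- Adding a state, which is the pushout of `C : ∅ → {0}`. -/
theorem isFiniteCellExt_insert {X : MDSpace} [T2Space X.carrier] [CompactSpace X.carrier]
    (hX : ∀ γ ∈ X.execPaths, γ 0 ≠ γ 1) {B : Set X.carrier} (hBc : IsClosed B)
    {p : X.carrier} (hp : p ∈ X.states) (hpB : p ∉ B) :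
    IsFiniteCellExt X B (insert p B) := by
  let P : MDSpaceH := ⟨discreteMD Empty, fun γ => (γ 0).elim⟩
  let Q : MDSpaceH := ⟨discreteMD Unit, fun γ => by
    convert isClosed_univ
    exact Set.eq_univ_of_forall fun x => ⟨0, rfl⟩⟩
  have : CompactSpace Q.obj.carrier := Finite.compactSpace (X := Unit)
  have : Nonempty Q.obj.carrier := ⟨()⟩
  let i : P ⟶ Q := ObjectProperty.homMk mapC
  have hi : IglC i.hom := Or.inr (MorphismProperty.prop_single _)
  refine IsFiniteCellExt.of_attach i hi (.const _ p)
    (fun _ _ _ => rfl) ?_ ?_ (fun _ _ => hp) (fun _ _ => .inr trivial) (fun _ h => h.elim) ?_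
  · rw [show range (ContinuousMap.const Q.obj.carrier p) = {p} from range_const, union_singleton]
  · intro q
    refine iff_of_false hpB ?_
    rintro ⟨e, _⟩
    exact (e : Empty).elim
  · intro E hE _ _ _ γ hγ hγB
    refine hE γ hγ ?_
    -- `p` is isolated in `insert p B`, and an execution path is not constant
    have hpc : _root_.IsPreconnected (range γ) := isPreconnected_range γ.continuous
    have := isPreconnected_iff_subset_of_disjoint_closed.1 hpc B {p} hBc isClosed_singleton
      (by rwa [union_singleton]) (by
        rw [(disjoint_singleton_right.2 hpB).inter_eq, inter_empty])
    refine this.resolve_right fun h => hX γ hγ ?_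
    exact (h ⟨0, rfl⟩ : γ 0 = p).trans (h ⟨1, rfl⟩ : γ 1 = p).symm

section Attaching

variable {n : ℕ} {F : Set (GlobeSpace (Disk n))}

instance : T2Space (globeSubdiv n F).carrier :=
  GlobeSpace.t2Space_of_subset (Metric.closedBall (0 : EuclideanSpace ℝ (Fin n)) 1)

instance : CompactSpace (globeSubdiv n F).carrier :=
  inferInstanceAs (CompactSpace (GlobeSpace (Disk n)))

instance : Nonempty (Disk n) := ⟨⟨0, by simp⟩⟩

/-- The globe of `Dᵏ` as a `Δ`-Hausdorff multipointed `d`-space. -/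
def globeDiskH (k : ℕ) : MDSpaceH :=
  ⟨globe (Disk k),
    haveI : T2Space (globe (Disk k)).carrier := GlobeSpace.t2Space_of_subset _
    MDSpace.isDeltaHausdorff_of_t2 _⟩

/-- The map `Glob(Sᵏ⁻¹) → Glob(Dᵏ)` over `Δ`-Hausdorff spaces. -/
def globeInclH (k : ℕ) : globeSphereH k ⟶ globeDiskH k := ObjectProperty.homMk (globeIncl k)

theorem IglC_globeInclH (k : ℕ) : IglC (globeInclH k).hom :=
  Or.inl (MorphismProperty.ofHoms.mk k)

instance (k : ℕ) : CompactSpace (globeDiskH k).obj.carrier :=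
  inferInstanceAs (CompactSpace (GlobeSpace (Disk k)))

theorem mem_range_globeIncl {k : ℕ} (w : Disk k) (t : I) :
    pt w t ∈ range (globeIncl k).map ↔ t = 0 ∨ t = 1 ∨ ‖(w : EuclideanSpace ℝ (Fin k))‖ = 1 := by
  constructor
  · rintro ⟨x, hx⟩
    change GlobeSpace.map (sphereIncl k) x = _ at hx
    induction x using GlobeSpace.ind with
    | h0 => exact .inl (congrArg height hx).symm
    | h1 => exact .inr (.inl (congrArg height hx).symm)
    | h z s =>
      rw [map_pt, pt_eq_pt_iff] at hx
      obtain ⟨rfl, h | h | rfl⟩ := hx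
      · exact .inl h
      · exact .inr (.inl h)
      · exact .inr (.inr (mem_sphere_zero_iff_norm.1 z.2))
  · rintro (rfl | rfl | h)
    · exact ⟨zero _, (pt_zero w).symm⟩
    · exact ⟨one _, (pt_one w).symm⟩
    · exact ⟨pt ⟨w, mem_sphere_zero_iff_norm.2 h⟩ t, rfl⟩

/-- The union of `{0,1}` and of the lines through the points of `A`. -/
def hull (A : Set (EuclideanSpace ℝ (Fin n))) : Set (GlobeSpace (Disk n)) :=
  {x | x = zero _ ∨ x = one _ ∨
    ∃ (z : Disk n) (t : I), (z : EuclideanSpace ℝ (Fin n)) ∈ A ∧ x = pt z t}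

theorem pt_mem_hull {A : Set (EuclideanSpace ℝ (Fin n))} {z : Disk n} {t : I} :
    pt z t ∈ hull A ↔ t = 0 ∨ t = 1 ∨ (z : EuclideanSpace ℝ (Fin n)) ∈ A := by
  constructor
  · rintro (h | h | ⟨z', t', hz, h⟩)
    · exact .inl (congrArg height h)
    · exact .inr (.inl (congrArg height h))
    · obtain ⟨rfl, h | h | rfl⟩ := pt_eq_pt_iff.1 h
      · exact .inl h
      · exact .inr (.inl h)
      · exact .inr (.inr hz)
  · rintro (rfl | rfl | h)
    · exact .inl (pt_zero z)
    · exact .inr (.inl (pt_one z))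
    · exact .inr (.inr ⟨z, t, h, rfl⟩)

theorem zero_mem_hull (A : Set (EuclideanSpace ℝ (Fin n))) : zero _ ∈ hull A := .inl rfl

theorem one_mem_hull (A : Set (EuclideanSpace ℝ (Fin n))) : one _ ∈ hull A := .inr (.inl rfl)

/-- A directed path of the globe from `0` to `1` is an execution path. -/
theorem mem_globe_execPaths {Z : Type} [TopologicalSpace Z] {z : Z} {φ : C(I, I)}
    (hφ : Monotone φ) (h0 : φ 0 = 0) (h1 : φ 1 = 1) :
    (delta z).comp φ ∈ (globe Z).execPaths :=
  ⟨z, φ, mem_reparamM hφ h0 h1, rfl⟩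

/-- Attaching the globe of a cell of the disk, when all the states are already present. -/
theorem isFiniteCellExt_hull {k : ℕ} {A : Set (EuclideanSpace ℝ (Fin n))} (hF : F ⊆ hull A)
    (c : C(Disk k, Disk n)) (hc : Function.Injective c)
    (hcA : ∀ w, (c w : EuclideanSpace ℝ (Fin n)) ∈ A ↔ ‖(w : EuclideanSpace ℝ (Fin k))‖ = 1) :
    IsFiniteCellExt (globeSubdiv n F) (hull A)
      (hull (A ∪ range fun w => (c w : EuclideanSpace ℝ (Fin n)))) := by
  have hst : (globeSubdiv n F).states ⊆ hull A := by
    rintro x ((rfl | rfl) | hx)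
    · exact zero_mem_hull A
    · exact one_mem_hull A
    · exact hF hx
  refine IsFiniteCellExt.of_attach (X := globeSubdiv n F) (globeInclH k) (IglC_globeInclH k)
    (GlobeSpace.map c) (map_injective hc) ?_ ?_ ?_ (fun q hq => .inl (hst hq)) ?_ ?_
  · ext x
    obtain ⟨z, t, rfl⟩ := exists_pt (Z := Disk n) x
    change pt z t ∈ hull _ ↔ pt z t ∈ hull A ∨ pt z t ∈ range (GlobeSpace.map c)
    rw [pt_mem_hull, pt_mem_hull]
    constructor
    · rintro (h | h | h | ⟨w, h⟩)
      · exact .inl (.inl h)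
      · exact .inl (.inr (.inl h))
      · exact .inl (.inr (.inr h))
      · exact .inr ⟨pt w t, pt_eq_pt_iff.2 ⟨rfl, .inr (.inr (Subtype.ext h))⟩⟩
    · rintro ((h | h | h) | ⟨q, h⟩)
      · exact .inl h
      · exact .inr (.inl h)
      · exact .inr (.inr (.inl h))
      · obtain ⟨w, s, rfl⟩ := exists_pt (Z := Disk k) q
        obtain ⟨rfl, h | h | rfl⟩ := pt_eq_pt_iff.1 (h : pt (c w) s = pt z t)
        · exact .inl h
        · exact .inr (.inl h)
        · exact .inr (.inr (.inr ⟨w, rfl⟩))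
  · intro q
    obtain ⟨w, s, rfl⟩ := exists_pt (Z := Disk k) q
    change pt (c w) s ∈ hull A ↔ pt w s ∈ range (globeIncl k).map
    rw [mem_range_globeIncl, pt_mem_hull, hcA]
  · intro q hq
    exact .inl ((globeMap c).map_states q hq)
  · intro γ hγ
    exact (globeToSubdiv n F).map_exec _ ((globeMap c).map_exec γ hγ)
  · intro E hE hE' _ _ γ hγ hγB
    by_cases h : range γ ⊆ hull A
    · exact hE γ hγ h
    · obtain ⟨hd, hs, ht, hne⟩ := hγ
      obtain ⟨z, φ, hφ, rfl⟩ := mem_dpaths_iff.1 hd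
      obtain ⟨_, ⟨u, rfl⟩, hu⟩ := Set.not_subset.1 h
      have hz : (z : EuclideanSpace ℝ (Fin n)) ∉ A := fun hz =>
        hu (pt_mem_hull.2 (.inr (.inr hz)))
      have hu' : pt z (φ u) ∉ hull A := hu
      -- the endpoints of the path lie on a new line and are old, so they are `0` and `1`
      have h0 : φ 0 = 0 ∨ φ 0 = 1 := (pt_mem_hull.1 (hst hs)).imp_right (Or.resolve_right · hz)
      have h1 : φ 1 = 0 ∨ φ 1 = 1 := (pt_mem_hull.1 (hst ht)).imp_right (Or.resolve_right · hz)
      have h0' : φ 0 = 0 := h0.resolve_right fun e => hu' (pt_mem_hull.2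
        (.inr (.inl (le_antisymm le_one' (e ▸ hφ nonneg')))))
      have h1' : φ 1 = 1 := h1.resolve_left fun e => hu' (pt_mem_hull.2
        (.inl (le_antisymm (e ▸ hφ le_one') nonneg')))
      have hzc : pt z (φ u) ∈ hull (A ∪ range fun w => (c w : EuclideanSpace ℝ (Fin n))) :=
        hγB ⟨u, rfl⟩
      rw [pt_mem_hull] at hu' hzc
      push Not at hu'
      obtain ⟨w, hw⟩ := ((hzc.resolve_left hu'.1).resolve_left hu'.2.1).resolve_left hz
      obtain rfl : c w = z := Subtype.ext hw
      exact hE' _ (mem_globe_execPaths (z := w) hφ h0' h1')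

/-- Attaching the segment between two states of a line, with no state in between, along the
globe of `D⁰`. -/
theorem isFiniteCellExt_segment {B : Set (GlobeSpace (Disk n))}
    (hst : (globeSubdiv n F).states ⊆ B) {z : Disk n} {a b : I} (hab : a < b)
    (ha : pt z a ∈ (globeSubdiv n F).states) (hb : pt z b ∈ (globeSubdiv n F).states)
    (hB : ∀ t, a < t → t < b → pt z t ∉ B) :
    IsFiniteCellExt (globeSubdiv n F) B (B ∪ pt z '' Icc a b) := by
  have hsa : ∀ t, t = a → pt z t ∈ (globeSubdiv n F).states := by rintro _ rfl; exact ha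
  have hsb : ∀ t, t = b → pt z t ∈ (globeSubdiv n F).states := by rintro _ rfl; exact hb
  have hsub : ∀ w w' : Disk 0, w = w' := fun w w' => Subtype.ext (Subsingleton.elim _ _)
  let g : C(GlobeSpace (Disk 0), GlobeSpace (Disk n)) :=
    ((delta z).comp (affPath a b)).comp ⟨height, continuous_height⟩
  have hgpt : ∀ w t, g (pt w t) = pt z (affPath a b t) := fun _ _ => rfl
  have hmid : ∀ t, pt z t ∈ B → a ≤ t → t ≤ b → t = a ∨ t = b := by
    intro t ht h1 h2
    rcases h1.eq_or_lt with h | h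
    · exact .inl h.symm
    · rcases h2.eq_or_lt with h' | h'
      · exact .inr h'
      · exact (hB t h h' ht).elim
  have hmem : ∀ t : I, a ≤ affPath a b t ∧ affPath a b t ≤ b := fun t =>
    ⟨(affPath_zero a b).ge.trans (affPath_monotone hab.le nonneg'),
      (affPath_monotone hab.le le_one').trans (affPath_one a b).le⟩
  refine IsFiniteCellExt.of_attach (X := globeSubdiv n F) (globeInclH 0) (IglC_globeInclH 0)
    g ?_ ?_ ?_ ?_ ?_ ?_ ?_
  · intro x y h
    obtain ⟨w, s, rfl⟩ := exists_pt (Z := Disk 0) x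
    obtain ⟨w', s', rfl⟩ := exists_pt (Z := Disk 0) y
    rw [hsub w' w]
    exact congrArg (pt w) ((affPath_strictMono hab).injective (congrArg height h))
  · congr 1
    ext x
    constructor
    · rintro ⟨t, ⟨h1, h2⟩, rfl⟩
      obtain ⟨u, hu⟩ := exists_unitInterval_apply_eq (φ := affPath a b) ((affPath_zero a b).le.trans h1)
        (h2.trans (affPath_one a b).ge)
      exact ⟨pt (Classical.arbitrary (Disk 0)) u, (hgpt _ u).trans (by rw [hu])⟩
    · rintro ⟨x, rfl⟩
      obtain ⟨w, s, rfl⟩ := exists_pt (Z := Disk 0) x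
      exact ⟨_, hmem s, rfl⟩
  · intro q
    obtain ⟨w, s, rfl⟩ := exists_pt (Z := Disk 0) q
    have h1 : pt w s ∈ range (globeIncl 0).map ↔ s = 0 ∨ s = 1 := by
      rw [mem_range_globeIncl, Subsingleton.elim (w : EuclideanSpace ℝ (Fin 0)) 0]
      simp
    refine Iff.trans ?_ h1.symm
    constructor
    · intro h
      rcases hmid _ h (hmem s).1 (hmem s).2 with h | h
      · exact .inl ((affPath_strictMono hab).injective (h.trans (affPath_zero a b).symm))
      · exact .inr ((affPath_strictMono hab).injective (h.trans (affPath_one a b).symm))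
    · rintro (rfl | rfl)
      · exact hst (hsa _ (affPath_zero a b))
      · exact hst (hsb _ (affPath_one a b))
  · rintro q (rfl | rfl)
    · exact hsa _ (affPath_zero a b)
    · exact hsb _ (affPath_one a b)
  · exact fun q hq => .inl (hst hq)
  · rintro _ ⟨w, φ, hφ, rfl⟩
    have h0 : affPath a b (φ 0) = a := by rw [reparamM_zero hφ, affPath_zero]
    have h1 : affPath a b (φ 1) = b := by rw [reparamM_one hφ, affPath_one]
    refine ⟨mem_dpaths_iff.2 ⟨z, (affPath a b).comp φ, (affPath_monotone hab.le).comp hφ.1, rfl⟩,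
      ?_, ?_, fun h => ?_⟩
    · exact hsa _ h0
    · exact hsb _ h1
    · have : affPath a b (φ 0) = affPath a b (φ 1) := congrArg height h
      rw [h0, h1] at this
      exact hab.ne this
  · intro E hE hE' hEr hEc γ hγ hγB
    by_cases h : range γ ⊆ B
    · exact hE γ hγ h
    obtain ⟨hd, hs, ht, hne⟩ := hγ
    obtain ⟨z', φ, hφ, rfl⟩ := mem_dpaths_iff.1 hd
    obtain ⟨_, ⟨u, rfl⟩, hu⟩ := Set.not_subset.1 h
    have hu' : pt z' (φ u) ∉ B := hu
    have h0B : pt z' 0 ∈ B := by rw [pt_zero]; exact hst (.inl (.inl rfl))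
    have h1B : pt z' 1 ∈ B := by rw [pt_one]; exact hst (.inl (.inr rfl))
    obtain ⟨t, ⟨hat, htb⟩, hpt⟩ := (hγB ⟨u, rfl⟩).resolve_left hu
    obtain ⟨htu, hz⟩ := pt_eq_pt_iff.1 (hpt : pt z t = pt z' (φ u))
    obtain rfl : z = z' := by
      rcases hz with h | h | h
      · rw [← htu, h] at hu'; exact (hu' h0B).elim
      · rw [← htu, h] at hu'; exact (hu' h1B).elim
      · exact h
    -- the path meets the open segment, so it traverses the whole segment
    have haφ : φ 0 ≤ a := by
      by_contra! hlt
      rcases hmid _ (hst hs) hlt.le ((hφ nonneg').trans (htu ▸ htb)) with h | h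
      · exact hlt.ne' h
      · exact hu' (hst (hsb _ (le_antisymm (htu ▸ htb) (h ▸ hφ nonneg'))))
    have hφb : b ≤ φ 1 := by
      by_contra! hlt
      rcases hmid _ (hst ht) (hat.trans (htu ▸ hφ le_one')) hlt.le with h | h
      · exact hu' (hst (hsa _ (le_antisymm (h ▸ hφ le_one') (htu ▸ hat))))
      · exact hlt.ne h
    -- subpaths before or after the segment are already present
    have old : ∀ {ψ : C(I, I)}, Monotone ψ → ψ 0 < ψ 1 → pt z (ψ 0) ∈ (globeSubdiv n F).states →
        pt z (ψ 1) ∈ (globeSubdiv n F).states → (∀ s, ψ s ∈ range φ) → (ψ 1 ≤ a ∨ b ≤ ψ 0) →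
        (delta z).comp ψ ∈ E := by
      intro ψ hψ hlt h0 h1 hr hab'
      refine hE _ ⟨mem_dpaths_iff.2 ⟨z, ψ, hψ, rfl⟩, h0, h1, fun h =>
        hlt.ne (congrArg height h)⟩ ?_
      rintro _ ⟨s, rfl⟩
      obtain ⟨s', hs'⟩ := hr s
      have hm : pt z (ψ s) ∈ B ∪ pt z '' Icc a b := hs' ▸ hγB ⟨s', rfl⟩
      rcases hm with hm | ⟨t, ⟨h1, h2⟩, hm⟩
      · exact hm
      · obtain rfl : t = ψ s := congrArg height hm
        change pt z (ψ s) ∈ B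
        rcases hab' with h' | h'
        · exact hst (hsa _ (le_antisymm ((hψ le_one').trans h') h1))
        · exact hst (hsb _ (le_antisymm h2 (h'.trans (hψ nonneg'))))
    -- subpaths which traverse exactly the segment are execution paths of the new cell
    have new : ∀ {ψ : C(I, I)}, Monotone ψ → ψ 0 = a → ψ 1 = b → (delta z).comp ψ ∈ E := by
      intro ψ hψ h0 h1
      obtain ⟨χ, hχ, rfl⟩ := exists_eq_affPath_comp hab hψ h0 h1
      exact hE' ((delta (Classical.arbitrary (Disk 0))).comp χ) ⟨_, χ, hχ, rfl⟩
    -- subpaths which start at the beginning of the segment are cut at its end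
    have upper : ∀ {ψ : C(I, I)}, Monotone ψ → ψ 0 = a → b ≤ ψ 1 → (∀ s, ψ s ∈ range φ) →
        pt z (ψ 1) ∈ (globeSubdiv n F).states → (delta z).comp ψ ∈ E := by
      intro ψ hψ h0 h1 hr hs1
      rcases h1.eq_or_lt with h1 | h1
      · exact new hψ h0 h1.symm
      obtain ⟨v, hv⟩ := exists_unitInterval_apply_eq (φ := ψ) (c := b) (h0.le.trans hab.le) h1.le
      have v0 : 0 < v := by
        refine lt_of_le_of_ne nonneg' fun e => hab.ne ?_
        rw [← h0, ← hv, e]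
      have v1 : v < 1 := by
        refine lt_of_le_of_ne le_one' fun e => h1.ne ?_
        rw [← hv, e]
      obtain ⟨χ, hχ, hc, he⟩ := exists_eq_normComp_comp ((delta z).comp ψ) v0 v1
      rw [he]
      refine hEr _ (hEc _ ?_ _ ?_ hc) χ hχ
      · refine new (ψ := ψ.comp (affPath 0 v)) (hψ.comp (affPath_monotone v0.le)) ?_ ?_
        · rw [ContinuousMap.comp_apply, affPath_zero, h0]
        · rw [ContinuousMap.comp_apply, affPath_one, hv]
      · have e0 : ψ.comp (affPath v 1) 0 = b := by
          rw [ContinuousMap.comp_apply, affPath_zero, hv]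
        have e1 : ψ.comp (affPath v 1) 1 = ψ 1 := by
          rw [ContinuousMap.comp_apply, affPath_one]
        refine old (ψ := ψ.comp (affPath v 1)) (hψ.comp (affPath_monotone v1.le)) ?_ ?_ ?_
          (fun s => hr _) ?_
        · rw [e0, e1]; exact h1
        · rw [e0]; exact hb
        · rw [e1]; exact hs1
        · exact .inr e0.ge
    rcases haφ.eq_or_lt with h0 | h0
    · exact upper hφ h0 hφb (fun s => ⟨s, rfl⟩) ht
    obtain ⟨v, hv⟩ := exists_unitInterval_apply_eq (φ := φ) (c := a) h0.le (hab.le.trans hφb)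
    have v0 : 0 < v := by
      refine lt_of_le_of_ne nonneg' fun e => h0.ne ?_
      rw [← hv, e]
    have v1 : v < 1 := by
      refine lt_of_le_of_ne le_one' fun e => (hab.trans_le hφb).ne ?_
      rw [← hv, e]
    obtain ⟨χ, hχ, hc, he⟩ := exists_eq_normComp_comp ((delta z).comp φ) v0 v1
    rw [he]
    refine hEr _ (hEc _ ?_ _ ?_ hc) χ hχ
    · have e0 : φ.comp (affPath 0 v) 0 = φ 0 := by
        rw [ContinuousMap.comp_apply, affPath_zero]
      have e1 : φ.comp (affPath 0 v) 1 = a := by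
        rw [ContinuousMap.comp_apply, affPath_one, hv]
      refine old (ψ := φ.comp (affPath 0 v)) (hφ.comp (affPath_monotone v0.le)) ?_ ?_ ?_
        (fun s => ⟨_, rfl⟩) ?_
      · rw [e0, e1]; exact h0
      · rw [e0]; exact hs
      · rw [e1]; exact ha
      · exact .inl e1.le
    · have e0 : φ.comp (affPath v 1) 0 = a := by
        rw [ContinuousMap.comp_apply, affPath_zero, hv]
      have e1 : φ.comp (affPath v 1) 1 = φ 1 := by
        rw [ContinuousMap.comp_apply, affPath_one]
      refine upper (ψ := φ.comp (affPath v 1)) (hφ.comp (affPath_monotone v1.le)) e0 ?_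
        (fun s => ⟨_, rfl⟩) ?_
      · rw [e1]; exact hφb
      · rw [e1]; exact ht

end Attaching

section Subdivision

variable {n : ℕ} {F : Set (GlobeSpace (Disk n))}

theorem hull_mono {A A' : Set (EuclideanSpace ℝ (Fin n))} (h : A ⊆ A') : hull A ⊆ hull A' := by
  rintro x (hx | hx | ⟨z, t, hz, hx⟩)
  · exact .inl hx
  · exact .inr (.inl hx)
  · exact .inr (.inr ⟨z, t, h hz, hx⟩)

/-! ### Adding the states and the lines that contain them -/

theorem isFiniteCellExt_union_states {X : MDSpace} [T2Space X.carrier] [CompactSpace X.carrier]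
    (hX : ∀ γ ∈ X.execPaths, γ 0 ≠ γ 1) {B : Set X.carrier} {S : Set X.carrier} (hS : S.Finite)
    (hSX : S ⊆ X.states) : IsFiniteCellExt X B (B ∪ S) := by
  induction S, hS using Set.Finite.induction_on with
  | empty => rw [union_empty]; exact .refl B
  | @insert p S _ _ ih =>
    rw [insert_subset_iff] at hSX
    refine (ih hSX.2).trans ?_
    rw [union_insert]
    by_cases hp : p ∈ B ∪ S
    · rw [insert_eq_of_mem hp]; exact .refl _
    · exact ⟨subset_insert _ _, fun hB hc => (isFiniteCellExt_insert hX hc hSX.1 hp).2 hB hc⟩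

theorem globeSubdiv_ne {γ : C(I, (globeSubdiv n F).carrier)}
    (hγ : γ ∈ (globeSubdiv n F).execPaths) : γ 0 ≠ γ 1 := hγ.2.2.2

/-- Filling a segment of a line between two states, by cutting it at the states it contains. -/
theorem isFiniteCellExt_fill (hF : F.Finite) {z : Disk n} (m : ℕ) :
    ∀ {B : Set (GlobeSpace (Disk n))} {a b : I}, (globeSubdiv n F).states ⊆ B → a < b →
      pt z a ∈ (globeSubdiv n F).states → pt z b ∈ (globeSubdiv n F).states →
      (∀ t, a < t → t < b → pt z t ∈ B → pt z t ∈ (globeSubdiv n F).states) →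
      {t | a < t ∧ t < b ∧ pt z t ∈ (globeSubdiv n F).states}.ncard = m →
      IsFiniteCellExt (globeSubdiv n F) B (B ∪ pt z '' Icc a b) := by
  induction m using Nat.strong_induction_on with
  | _ m ih =>
  intro B a b hst hab ha hb hB hm
  have hfin : ∀ a b, {t | a < t ∧ t < b ∧ pt z t ∈ (globeSubdiv n F).states}.Finite := by
    intro a b
    have : ((globeSubdiv n F).states).Finite := ((Set.toFinite {zero _, one _}).union hF :)
    exact (this.image height).subset fun t ht => ⟨pt z t, ht.2.2, rfl⟩
  by_cases h : ∃ c, a < c ∧ c < b ∧ pt z c ∈ (globeSubdiv n F).states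
  · obtain ⟨c, hac, hcb, hc⟩ := h
    have lt₁ : {t | a < t ∧ t < c ∧ pt z t ∈ (globeSubdiv n F).states}.ncard < m := by
      rw [← hm]
      refine Set.ncard_lt_ncard ⟨fun t ht => ⟨ht.1, ht.2.1.trans hcb, ht.2.2⟩, fun h => ?_⟩
        (hfin a b)
      exact (h ⟨hac, hcb, hc⟩ : a < c ∧ c < c ∧ _).2.1.false
    have lt₂ : {t | c < t ∧ t < b ∧ pt z t ∈ (globeSubdiv n F).states}.ncard < m := by
      rw [← hm]
      refine Set.ncard_lt_ncard ⟨fun t ht => ⟨hac.trans ht.1, ht.2.1, ht.2.2⟩, fun h => ?_⟩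
        (hfin a b)
      exact (h ⟨hac, hcb, hc⟩ : c < c ∧ _).1.false
    have h₁ := ih _ lt₁ hst hac ha hc (fun t h h' => hB t h (h'.trans hcb)) rfl
    have h₂ := ih _ lt₂ (B := B ∪ pt z '' Icc a c) (hst.trans subset_union_left) hcb hc hb
      (fun t h h' ht => by
        rcases ht with ht | ⟨s, hs, hst⟩
        · exact hB t (hac.trans h) h' ht
        · obtain rfl : s = t := congrArg height hst
          exact (h.not_ge hs.2).elim) rfl
    have : B ∪ pt z '' Icc a b = B ∪ pt z '' Icc a c ∪ pt z '' Icc c b := by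
      rw [union_assoc, ← image_union, Icc_union_Icc_eq_Icc hac.le hcb.le]
    exact (congrArg (IsFiniteCellExt (globeSubdiv n F) B) this).mpr (IsFiniteCellExt.trans h₁ h₂)
  · push Not at h
    exact isFiniteCellExt_segment hst hab ha hb fun t h1 h2 ht => h t h1 h2 (hB t h1 h2 ht)

/-- Filling the lines of finitely many points of the disk. -/
theorem isFiniteCellExt_lines (hF : F.Finite) (A : Set (EuclideanSpace ℝ (Fin n)))
    {Z : Set (EuclideanSpace ℝ (Fin n))} (hZ : Z.Finite) (hZb : Z ⊆ Metric.closedBall 0 1) :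
    IsFiniteCellExt (globeSubdiv n F) (hull A ∪ F) (hull (A ∪ Z) ∪ F) := by
  induction Z, hZ using Set.Finite.induction_on with
  | empty => rw [union_empty]; exact .refl _
  | @insert z Z _ _ ih =>
    rw [insert_subset_iff] at hZb
    refine (ih hZb.2).trans ?_
    rw [union_insert]
    by_cases hz : z ∈ A ∪ Z
    · rw [insert_eq_of_mem hz]; exact .refl _
    let z' : Disk n := ⟨z, hZb.1⟩
    have h := isFiniteCellExt_fill hF (z := z') _ (B := hull (A ∪ Z) ∪ F) (a := 0) (b := 1)
      ?_ zero_lt_one ?_ ?_ ?_ rfl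
    · refine (congrArg (IsFiniteCellExt (globeSubdiv n F) _) ?_).mpr h
      ext x
      obtain ⟨y, t, rfl⟩ := exists_pt (Z := Disk n) x
      change (pt y t ∈ hull _ ∨ pt y t ∈ F) ↔ ((pt y t ∈ hull _ ∨ pt y t ∈ F) ∨ _)
      rw [pt_mem_hull, pt_mem_hull, mem_insert_iff]
      constructor
      · rintro ((h | h | h | h) | h)
        · exact .inl (.inl (.inl h))
        · exact .inl (.inl (.inr (.inl h)))
        · obtain rfl : y = z' := Subtype.ext h
          exact .inr ⟨t, ⟨nonneg', le_one'⟩, rfl⟩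
        · exact .inl (.inl (.inr (.inr h)))
        · exact .inl (.inr h)
      · rintro (((h | h | h) | h) | ⟨s, _, h⟩)
        · exact .inl (.inl h)
        · exact .inl (.inr (.inl h))
        · exact .inl (.inr (.inr (.inr h)))
        · exact .inr h
        · obtain ⟨rfl, h | h | rfl⟩ := pt_eq_pt_iff.1 h
          · exact .inl (.inl h)
          · exact .inl (.inr (.inl h))
          · exact .inl (.inr (.inr (.inl rfl)))
    · rintro x ((rfl | rfl) | hx)
      · exact .inl (zero_mem_hull _)
      · exact .inl (one_mem_hull _)
      · exact .inr hx
    · exact .inl (.inl (pt_zero z'))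
    · exact .inl (.inr (pt_one z'))
    · rintro t h0 h1 (ht | ht)
      · exact ((hz (((pt_mem_hull.1 ht).resolve_left h0.ne').resolve_left h1.ne)).elim)
      · exact .inr ht

/-! ### Convex cells -/

/-- For a hyperplane through an interior point `p` of a convex set, the interior of the slice is
the slice of the interior. -/
theorem mem_interior_slice_iff {E : Type} [NormedAddCommGroup E] [NormedSpace ℝ E]
    {K : Set E} (hKc : Convex ℝ K) {p : E} (hp : p ∈ interior K)
    (H : Submodule ℝ E) (x : H) :
    x ∈ interior ((fun y : H => p + (y : E)) ⁻¹' K) ↔ p + (x : E) ∈ interior K := by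
  have hc : Continuous fun y : H => p + (y : E) := by fun_prop
  refine ⟨fun hx => ?_, fun hx => preimage_interior_subset_interior_preimage hc hx⟩
  have ht : Filter.Tendsto (fun ε : ℝ => (1 + ε) • x) (𝓝 0) (𝓝 x) := by
    have : Continuous fun ε : ℝ => (1 + ε) • x := by fun_prop
    simpa using this.tendsto 0
  -- `x` is strictly between `0` and a point of the slice
  obtain ⟨ε, hε, h0⟩ := (((ht.eventually (isOpen_interior.mem_nhds hx)).filter_mono
    nhdsWithin_le_nhds).and (self_mem_nhdsWithin (s := Ioi 0))).exists
  have h0' : (0 : ℝ) < 1 + ε := by have : 0 < ε := h0; linarith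
  have hy : p + (((1 + ε) • x : H) : E) ∈ K := interior_subset (s := (fun y : H => p + (y : E)) ⁻¹' K) hε
  refine hKc.openSegment_interior_self_subset_interior hp hy
    ⟨ε / (1 + ε), 1 / (1 + ε), div_pos h0 h0', div_pos one_pos h0', by field_simp; ring, ?_⟩
  rw [smul_add, ← add_assoc, ← add_smul, Submodule.coe_smul, smul_smul]
  have h1 : ε / (1 + ε) + 1 / (1 + ε) = 1 := by field_simp; ring
  have h2 : 1 / (1 + ε) * (1 + ε) = 1 := by field_simp
  rw [h1, h2, one_smul, one_smul]

variable {E : Type} [NormedAddCommGroup E] [NormedSpace ℝ E] [FiniteDimensional ℝ E]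

/-- A convex body is a closed disk, so it can be attached as one cell if it meets `A` exactly along
its boundary. -/
theorem isFiniteCellExt_convex_of_forall {K : Set E} (hKc : Convex ℝ K) (hK : IsCompact K)
    (hKn : (interior K).Nonempty) {j : E → EuclideanSpace ℝ (Fin n)} (hj : ContinuousOn j K)
    (hinj : InjOn j K) (hjb : MapsTo j K (Metric.closedBall 0 1))
    {A : Set (EuclideanSpace ℝ (Fin n))} (hF : F ⊆ hull A)
    (hA : ∀ x ∈ K, j x ∈ A ↔ x ∉ interior K) :
    IsFiniteCellExt (globeSubdiv n F) (hull A) (hull (A ∪ j '' K)) := by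
  obtain ⟨e⟩ : Nonempty (E ≃L[ℝ] EuclideanSpace ℝ (Fin (Module.finrank ℝ E))) :=
    ⟨ContinuousLinearEquiv.ofFinrankEq (by simp)⟩
  have hint : e '' interior K = interior (e '' K) := e.toHomeomorph.image_interior K
  obtain ⟨h, hh, hh', -⟩ := exists_homeomorph_image_interior_closure_frontier_eq_unitBall
    (s := e '' K) (hKc.is_linear_image (f := e) ⟨map_add e, map_smul e⟩) (hint ▸ hKn.image e)
    (hK.image e.continuous).isBounded
  rw [(hK.image e.continuous).isClosed.closure_eq] at hh'
  rw [← hint] at hh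
  let ψ : E ≃ₜ EuclideanSpace ℝ (Fin (Module.finrank ℝ E)) := e.toHomeomorph.trans h
  have hψ : ψ '' K = Metric.closedBall 0 1 := by rw [← hh', image_image]; rfl
  have hψ' : ψ '' interior K = Metric.ball 0 1 := by rw [← hh, image_image]; rfl
  have hmem : ∀ w : Disk (Module.finrank ℝ E), ψ.symm w ∈ K := by
    intro w
    obtain ⟨x, hx, hxw⟩ : (w : EuclideanSpace ℝ (Fin (Module.finrank ℝ E))) ∈ ψ '' K := by
      rw [hψ]; exact w.2
    rw [← hxw, ψ.symm_apply_apply]; exact hx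
  let c : C(Disk (Module.finrank ℝ E), Disk n) :=
    ⟨fun w => ⟨j (ψ.symm w), hjb (hmem w)⟩, Continuous.subtype_mk
      (hj.comp_continuous (ψ.symm.continuous.comp continuous_subtype_val) hmem) _⟩
  have hr : range (fun w => (c w : EuclideanSpace ℝ (Fin n))) = j '' K := by
    ext y
    constructor
    · rintro ⟨w, rfl⟩
      exact ⟨_, hmem w, rfl⟩
    · rintro ⟨x, hx, rfl⟩
      refine ⟨⟨ψ x, hψ ▸ mem_image_of_mem ψ hx⟩, ?_⟩
      exact congrArg j (ψ.symm_apply_apply x)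
  rw [← hr]
  refine isFiniteCellExt_hull hF c ?_ ?_
  · intro w w' hw
    exact Subtype.ext (ψ.symm.injective (hinj (hmem w) (hmem w') (congrArg Subtype.val hw)))
  · intro w
    have hi : ψ.symm w ∈ interior K ↔
        (w : EuclideanSpace ℝ (Fin (Module.finrank ℝ E))) ∈ Metric.ball 0 1 := by
      rw [← hψ']
      constructor
      · intro hx; exact ⟨_, hx, ψ.apply_symm_apply _⟩
      · rintro ⟨x, hx, hxw⟩
        rw [← hxw, ψ.symm_apply_apply]; exact hx
    have hw : ‖(w : EuclideanSpace ℝ (Fin (Module.finrank ℝ E)))‖ ≤ 1 :=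
      mem_closedBall_zero_iff.1 w.2
    change j (ψ.symm w) ∈ A ↔ _
    rw [hA _ (hmem w), hi, mem_ball_zero_iff, not_lt]
    exact ⟨fun h => le_antisymm hw h, fun h => h.ge⟩

theorem interior_inter_halfspace {K : Set E} {l : E →L[ℝ] ℝ} (hl : l ≠ 0) (a : ℝ) :
    interior (K ∩ l ⁻¹' Ici a) = interior K ∩ l ⁻¹' Ioi a := by
  have hs : Function.Surjective l := LinearMap.surjective (f := (l : E →ₗ[ℝ] ℝ)) fun h =>
    hl (ContinuousLinearMap.coe_injective h)
  rw [interior_inter, l.interior_preimage hs, interior_Ici]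

/-- A convex body can be attached by finitely many cells if it meets `A` exactly along its boundary
and in finitely many interior points: it is cut along a hyperplane through one of these points into
a slice of lower dimension and two halves with fewer points in their interior. -/
theorem isFiniteCellExt_convex {Z : Set (EuclideanSpace ℝ (Fin n))} (hZ : Z.Finite) (d : ℕ) :
    ∀ (m : ℕ) {E : Type} [NormedAddCommGroup E] [NormedSpace ℝ E] [FiniteDimensional ℝ E]
      (_ : Module.finrank ℝ E = d) {K : Set E} (_ : Convex ℝ K) (_ : IsCompact K)
      (_ : (interior K).Nonempty) {j : E → EuclideanSpace ℝ (Fin n)} (_ : ContinuousOn j K)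
      (_ : InjOn j K) (_ : MapsTo j K (Metric.closedBall 0 1))
      (_ : {x | x ∈ interior K ∧ j x ∈ Z}.ncard = m)
      {A : Set (EuclideanSpace ℝ (Fin n))} (_ : F ⊆ hull A)
      (_ : ∀ x ∈ K, j x ∈ A ↔ x ∉ interior K ∨ j x ∈ Z),
      IsFiniteCellExt (globeSubdiv n F) (hull A) (hull (A ∪ j '' K)) := by
  induction d using Nat.strong_induction_on with
  | _ d ihd =>
  intro m
  induction m using Nat.strong_induction_on with
  | _ m ihm =>
  intro E _ _ _ hd K hKc hK hKn j hj hinj hjb hm A hF hA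
  by_cases hex : ∃ p ∈ interior K, j p ∈ Z
  swap
  · push Not at hex
    refine isFiniteCellExt_convex_of_forall hKc hK hKn hj hinj hjb hF fun x hx => ?_
    rw [hA x hx]
    exact ⟨fun h => h.elim id fun h h' => hex x h' h, .inl⟩
  obtain ⟨p, hp, hpZ⟩ := hex
  have hpK := interior_subset hp
  rcases subsingleton_or_nontrivial E with hE | hE
  · have : A ∪ j '' K = A := by
      refine union_eq_left.2 ?_
      rintro _ ⟨x, hx, rfl⟩
      obtain rfl : x = p := Subsingleton.elim _ _
      exact (hA x hx).2 (.inr hpZ)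
    rw [this]
    exact .refl _
  obtain ⟨v, hv⟩ := exists_ne (0 : E)
  obtain ⟨l, hlv⟩ := SeparatingDual.exists_ne_zero (R := ℝ) hv
  have hl : l ≠ 0 := by rintro rfl; exact hlv rfl
  -- the half of `K` on one side of the hyperplane, once the slice is present
  have half : ∀ l : E →L[ℝ] ℝ, l ≠ 0 → ∀ A' : Set (EuclideanSpace ℝ (Fin n)), F ⊆ hull A' →
      (∀ x ∈ K, l p ≤ l x → (j x ∈ A' ↔ (x ∉ interior K ∨ j x ∈ Z) ∨ l x = l p)) →
      IsFiniteCellExt (globeSubdiv n F) (hull A') (hull (A' ∪ j '' (K ∩ l ⁻¹' Ici (l p)))) := by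
    intro l hl A' hF' hA'
    have hint := interior_inter_halfspace (K := K) hl (l p)
    have hlt : {x | x ∈ interior (K ∩ l ⁻¹' Ici (l p)) ∧ j x ∈ Z}.ncard < m := by
      rw [← hm, hint]
      have hfin : {x | x ∈ interior K ∧ j x ∈ Z}.Finite :=
        Set.Finite.of_finite_image (hZ.subset (by rintro _ ⟨x, hx, rfl⟩; exact hx.2))
          (hinj.mono fun x hx => interior_subset hx.1)
      refine Set.ncard_lt_ncard ⟨fun x hx => ⟨hx.1.1, hx.2⟩, fun h => ?_⟩ hfin
      exact lt_irrefl (l p) (h ⟨hp, hpZ⟩).1.2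
    have hcl : IsClosed (l ⁻¹' Ici (l p)) := isClosed_Ici.preimage l.continuous
    refine ihm _ hlt hd (hKc.inter ((convex_Ici (l p)).linear_preimage (l : E →ₗ[ℝ] ℝ)))
      (hK.inter_right hcl) ?_ (hj.mono inter_subset_left) (hinj.mono inter_subset_left)
      (hjb.mono_left inter_subset_left) rfl hF' ?_
    · change (interior (K ∩ l ⁻¹' Ici (l p))).Nonempty
      rw [hint]
      by_contra hne
      have hsub : interior K ⊆ K ∩ (-l) ⁻¹' Ici ((-l) p) := fun x hx => ⟨interior_subset hx, by
        have : ¬ l p < l x := fun h => hne ⟨x, hx, h⟩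
        simpa using this⟩
      have := interior_maximal hsub isOpen_interior hp
      rw [interior_inter_halfspace (neg_ne_zero.2 hl)] at this
      exact lt_irrefl ((-l) p) this.2
    · rintro x ⟨hx, hxl⟩
      have hxl' : l p ≤ l x := hxl
      change j x ∈ A' ↔ x ∉ interior (K ∩ l ⁻¹' Ici (l p)) ∨ j x ∈ Z
      rw [hA' x hx hxl', hint]
      simp only [mem_inter_iff, mem_preimage, mem_Ioi, not_and_or, not_lt]
      constructor
      · rintro ((h | h) | h)
        · exact .inl (.inl h)
        · exact .inr h
        · exact .inl (.inr h.le)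
      · rintro ((h | h) | h)
        · exact .inl (.inl h)
        · exact .inr (le_antisymm h hxl')
        · exact .inl (.inr h)
  let H : Submodule ℝ E := LinearMap.ker (l : E →ₗ[ℝ] ℝ)
  have hHd : Module.finrank ℝ H < d := by
    rw [← hd]
    exact Submodule.finrank_lt fun h => hl (ContinuousLinearMap.coe_injective
      (LinearMap.ker_eq_top.1 h))
  let i : H → E := fun y => p + (y : E)
  have hi : IsClosedEmbedding i := (Homeomorph.addLeft p).isClosedEmbedding.comp
    H.closed_of_finiteDimensional.isClosedEmbedding_subtypeVal
  have himg : ∀ x, x ∈ range i ↔ l x = l p := by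
    intro x
    constructor
    · rintro ⟨y, rfl⟩
      have : l (y : E) = 0 := y.2
      simp [i, this]
    · intro h
      exact ⟨⟨x - p, by simp [H, h]⟩, by simp [i]⟩
  have hslice : j ∘ i '' (i ⁻¹' K) = j '' (K ∩ {x | l x = l p}) := by
    rw [image_comp, image_preimage_eq_inter_range]
    congr 2
    ext x
    exact himg x
  have hcv : Convex ℝ (i ⁻¹' K) := by
    intro x hx y hy a b ha hb hab
    have : i (a • x + b • y) = a • i x + b • i y := by
      simp only [i, Submodule.coe_add, Submodule.coe_smul, smul_add]
      rw [add_add_add_comm, ← add_smul, hab, one_smul]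
    rw [mem_preimage, this]
    exact hKc hx hy ha hb hab
  have step₀ : IsFiniteCellExt (globeSubdiv n F) (hull A)
      (hull (A ∪ j '' (K ∩ {x | l x = l p}))) := by
    rw [← hslice]
    refine ihd _ hHd _ rfl hcv (hi.isCompact_preimage hK) ⟨0, ?_⟩
      (hj.comp hi.continuous.continuousOn fun _ h => h)
      (hinj.comp hi.injective.injOn fun _ h => h) (fun x hx => hjb hx) rfl hF ?_
    · exact (mem_interior_slice_iff hKc hp H 0).2 (by simpa using hp)
    · intro x hx
      rw [mem_interior_slice_iff hKc hp H x]
      exact hA _ hx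
  have hF₁ := hF.trans (hull_mono (subset_union_left (s := A) (t := j '' (K ∩ {x | l x = l p}))))
  have mem₁ : ∀ x ∈ K, j x ∈ A ∪ j '' (K ∩ {x | l x = l p}) ↔
      (x ∉ interior K ∨ j x ∈ Z) ∨ l x = l p := by
    intro x hx
    rw [mem_union, hA x hx]
    refine or_congr_right ⟨?_, fun h => ⟨x, ⟨hx, h⟩, rfl⟩⟩
    rintro ⟨y, ⟨hy, hyl⟩, hyx⟩
    exact hinj hy hx hyx ▸ hyl
  have step₁ := half l hl _ hF₁ fun x hx _ => mem₁ x hx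
  have step₂ := half (-l) (neg_ne_zero.2 hl)
    (A ∪ j '' (K ∩ {x | l x = l p}) ∪ j '' (K ∩ l ⁻¹' Ici (l p)))
    (hF₁.trans (hull_mono subset_union_left)) (fun x hx hxl => by
      have hxl' : l x ≤ l p := by simpa using hxl
      rw [mem_union, mem₁ x hx]
      have : (-l) x = (-l) p ↔ l x = l p := by simp
      rw [this]
      refine ⟨fun h => h.elim id ?_, .inl⟩
      rintro ⟨y, ⟨hy, hyl⟩, hyx⟩
      obtain rfl := hinj hy hx hyx
      exact .inr (le_antisymm hxl' hyl))
  have hfinal : A ∪ j '' (K ∩ {x | l x = l p}) ∪ j '' (K ∩ l ⁻¹' Ici (l p)) ∪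
      j '' (K ∩ (-l) ⁻¹' Ici ((-l) p)) = A ∪ j '' K := by
    rw [union_assoc, union_assoc, ← image_union, ← image_union, ← inter_union_distrib_left,
      ← inter_union_distrib_left]
    congr 2
    refine inter_eq_left.2 fun x _ => ?_
    rcases le_total (l p) (l x) with h | h
    · exact .inr (.inl h)
    · exact .inr (.inr (by simpa using h))
  rw [← hfinal]
  exact step₀.trans (step₁.trans step₂)

end Subdivision

/-! ### Hemispheres -/

section Hemisphere

variable {V : Type} [NormedAddCommGroup V] [InnerProductSpace ℝ V]

/-- The hemisphere on the side `s = ±1` of `u`, as a graph over the unit ball of a subspace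
orthogonal to `u`; outside of the unit ball this is the identity. -/
noncomputable def hemisphere (W : Submodule ℝ V) (u : V) (s : ℝ) (x : W) : V :=
  x + (s * √(1 - ‖x‖ ^ 2)) • u

variable {W : Submodule ℝ V} {u : V}

theorem continuous_hemisphere (s : ℝ) : Continuous (hemisphere W u s) := by
  unfold hemisphere; fun_prop

theorem inner_hemisphere (hu : u ∈ Wᗮ) (hu1 : ‖u‖ = 1) (s : ℝ) (x : W) :
    inner ℝ u (hemisphere W u s x) = s * √(1 - ‖x‖ ^ 2) := by
  have h0 : inner ℝ u (x : V) = 0 := Submodule.inner_left_of_mem_orthogonal x.2 hu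
  rw [hemisphere, inner_add_right, h0, inner_smul_right, real_inner_self_eq_norm_sq, hu1]
  ring

theorem hemisphere_eq_hemisphere (hu : u ∈ Wᗮ) (hu1 : ‖u‖ = 1) {s s' : ℝ} {x y : W}
    (h : hemisphere W u s x = hemisphere W u s' y) :
    x = y ∧ s * √(1 - ‖x‖ ^ 2) = s' * √(1 - ‖y‖ ^ 2) := by
  have h' : s * √(1 - ‖x‖ ^ 2) = s' * √(1 - ‖y‖ ^ 2) := by
    rw [← inner_hemisphere hu hu1, h, inner_hemisphere hu hu1]
  refine ⟨Subtype.ext ?_, h'⟩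
  rw [hemisphere, hemisphere, h'] at h
  exact add_right_cancel h

theorem norm_hemisphere (hu : u ∈ Wᗮ) (hu1 : ‖u‖ = 1) {s : ℝ} (hs : s ^ 2 = 1) {x : W}
    (hx : ‖x‖ ≤ 1) : ‖hemisphere W u s x‖ = 1 := by
  have h0 : inner ℝ (x : V) u = 0 := Submodule.inner_right_of_mem_orthogonal x.2 hu
  have hx' : 0 ≤ 1 - ‖x‖ ^ 2 := by nlinarith [norm_nonneg x]
  have : ‖hemisphere W u s x‖ ^ 2 = 1 := by
    rw [hemisphere, norm_add_sq_real, inner_smul_right, h0, norm_smul, hu1, mul_one,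
      Real.norm_eq_abs, sq_abs, mul_pow, hs, Real.sq_sqrt hx', Submodule.coe_norm]
    ring
  exact (pow_eq_one_iff_of_nonneg (norm_nonneg _) two_ne_zero).1 this

theorem exists_hemisphere_eq (hu : u ∈ Wᗮ) (hu1 : ‖u‖ = 1) {y : V} (hy : ‖y‖ = 1)
    (hyW : y - (inner ℝ u y : ℝ) • u ∈ W) :
    ∃ x : W, ‖x‖ ≤ 1 ∧ (hemisphere W u 1 x = y ∨ hemisphere W u (-1) x = y) := by
  let c : ℝ := inner ℝ u y
  let x : W := ⟨y - c • u, hyW⟩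
  have h0 : inner ℝ (x : V) u = 0 := Submodule.inner_right_of_mem_orthogonal x.2 hu
  have hyx : y = x + c • u := (sub_add_cancel y (c • u)).symm
  have h1 : ‖x‖ ^ 2 + c ^ 2 = 1 := by
    have : ‖y‖ ^ 2 = 1 := by rw [hy]; norm_num
    rw [hyx, norm_add_sq_real, inner_smul_right, h0, norm_smul, hu1, mul_one,
      Real.norm_eq_abs, sq_abs] at this
    rw [← Submodule.coe_norm] at this
    linarith
  have hx : 1 - ‖x‖ ^ 2 = c ^ 2 := by linarith
  refine ⟨x, by nlinarith [sq_nonneg c, norm_nonneg x], ?_⟩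
  rcases le_total 0 c with h | h
  · left
    rw [hemisphere, hx, Real.sqrt_sq h, one_mul, ← hyx]
  · right
    rw [hemisphere, hx, ← neg_sq, Real.sqrt_sq (neg_nonneg.2 h), neg_one_mul, neg_neg, ← hyx]

end Hemisphere

/-- The globe of a sphere is covered by the globes of two hemispheres. -/
instance compactSpace_globeSpace_bdSphere (n : ℕ) : CompactSpace (GlobeSpace (BdSphere n)) := by
  rcases isEmpty_or_nonempty (BdSphere n) with h | ⟨⟨u, hu⟩⟩
  · refine ⟨(toFinite {zero _, one _}).isCompact.of_isClosed_subset isClosed_univ ?_⟩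
    intro x _
    induction x using GlobeSpace.ind with
    | h0 => exact .inl rfl
    | h1 => exact .inr rfl
    | h z t => exact isEmptyElim z
  · have hu1 : ‖u‖ = 1 := mem_sphere_zero_iff_norm.1 hu
    let W : Submodule ℝ (EuclideanSpace ℝ (Fin n)) := (ℝ ∙ u)ᗮ
    have huW : u ∈ Wᗮ := Submodule.le_orthogonal_orthogonal _ (Submodule.mem_span_singleton_self u)
    let c (s : ℝ) (hs : s ^ 2 = 1) : C(Metric.closedBall (0 : W) 1, BdSphere n) :=
      ⟨fun x => ⟨hemisphere W u s x, mem_sphere_zero_iff_norm.2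
        (norm_hemisphere huW hu1 hs (mem_closedBall_zero_iff.1 x.2))⟩,
        ((continuous_hemisphere s).comp continuous_subtype_val).subtype_mk _⟩
    refine ⟨?_⟩
    have : (univ : Set (GlobeSpace (BdSphere n))) =
        range (GlobeSpace.map (c 1 (by norm_num))) ∪
          range (GlobeSpace.map (c (-1) (by norm_num))) := by
      refine (eq_univ_of_forall fun x => ?_).symm
      induction x using GlobeSpace.ind with
      | h0 => exact .inl ⟨zero _, rfl⟩
      | h1 => exact .inl ⟨one _, rfl⟩
      | h z t =>
        obtain ⟨x, hx, h⟩ := exists_hemisphere_eq huW hu1 (mem_sphere_zero_iff_norm.1 z.2) (by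
          rw [Submodule.mem_orthogonal_singleton_iff_inner_right, inner_sub_right,
            inner_smul_right, real_inner_self_eq_norm_sq, hu1]
          ring)
        rcases h with h | h
        · exact .inl ⟨pt ⟨x, mem_closedBall_zero_iff.2 hx⟩ t,
            congrArg (pt · t) (Subtype.ext h)⟩
        · exact .inr ⟨pt ⟨x, mem_closedBall_zero_iff.2 hx⟩ t,
            congrArg (pt · t) (Subtype.ext h)⟩
    rw [this]
    exact (isCompact_range (GlobeSpace.map _).continuous).union
      (isCompact_range (GlobeSpace.map _).continuous)

section Sphere

variable {n : ℕ} {F : Set (GlobeSpace (Disk n))}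

/-- The unit sphere of a subspace is attached by finitely many cells: two hemispheres are glued to
the unit sphere of a hyperplane of the subspace. -/
theorem isFiniteCellExt_sphere {Z : Set (EuclideanSpace ℝ (Fin n))} (hFZ : F ⊆ hull Z)
    (hZ : ∀ z ∈ Z, ‖z‖ ≠ 1) (W : Submodule ℝ (EuclideanSpace ℝ (Fin n))) :
    IsFiniteCellExt (globeSubdiv n F) (hull Z) (hull (Z ∪ {x | x ∈ W ∧ ‖x‖ = 1})) := by
  induction W using WellFoundedLT.induction with
  | ind W ih =>
  by_cases hW : ∃ u ∈ W, ‖u‖ = 1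
  swap
  · have : {x | x ∈ W ∧ ‖x‖ = 1} = (∅ : Set (EuclideanSpace ℝ (Fin n))) :=
      eq_empty_of_forall_notMem fun x hx => hW ⟨x, hx⟩
    rw [this, union_empty]
    exact .refl _
  obtain ⟨u, huW, hu1⟩ := hW
  let W' : Submodule ℝ (EuclideanSpace ℝ (Fin n)) := W ⊓ (ℝ ∙ u)ᗮ
  have hu : u ∈ W'ᗮ := Submodule.orthogonal_le inf_le_right
    (Submodule.le_orthogonal_orthogonal _ (Submodule.mem_span_singleton_self u))
  have hlt : W' < W := by
    refine lt_of_le_of_ne inf_le_left fun h => ?_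
    have h0 : inner ℝ u u = (0 : ℝ) :=
      Submodule.inner_right_of_mem_orthogonal (h.symm ▸ huW : u ∈ W') hu
    rw [real_inner_self_eq_norm_sq, hu1] at h0
    norm_num at h0
  have hK := isCompact_closedBall (0 : W') 1
  have hint : interior (Metric.closedBall (0 : W') 1) = Metric.ball 0 1 :=
    interior_closedBall _ one_ne_zero
  have hball : ∀ x : W', x ∈ Metric.closedBall (0 : W') 1 → (x ∉ interior
      (Metric.closedBall (0 : W') 1) ↔ √(1 - ‖x‖ ^ 2) = 0) := by
    intro x hx
    have hx' : ‖x‖ ≤ 1 := mem_closedBall_zero_iff.1 hx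
    rw [hint, mem_ball_zero_iff, not_lt, Real.sqrt_eq_zero (by nlinarith [norm_nonneg x])]
    constructor
    · intro h; rw [le_antisymm hx' h]; norm_num
    · intro h; nlinarith [norm_nonneg x]
  have hemi : ∀ s : ℝ, s ^ 2 = 1 → ∀ A : Set (EuclideanSpace ℝ (Fin n)), F ⊆ hull A →
      (∀ x ∈ Metric.closedBall (0 : W') 1,
        hemisphere W' u s x ∈ A ↔ √(1 - ‖x‖ ^ 2) = 0) →
      IsFiniteCellExt (globeSubdiv n F) (hull A)
        (hull (A ∪ hemisphere W' u s '' Metric.closedBall 0 1)) := by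
    intro s hs A hF hA
    refine isFiniteCellExt_convex_of_forall (convex_closedBall 0 1) hK ?_
      (continuous_hemisphere s).continuousOn
      (fun x _ y _ h => (hemisphere_eq_hemisphere hu hu1 h).1) ?_ hF ?_
    · rw [hint]; exact ⟨0, Metric.mem_ball_self one_pos⟩
    · intro x hx
      exact mem_closedBall_zero_iff.2
        (norm_hemisphere hu hu1 hs (mem_closedBall_zero_iff.1 hx)).le
    · intro x hx
      rw [hA x hx, hball x hx]
  have memA : ∀ s : ℝ, s ^ 2 = 1 → ∀ x ∈ Metric.closedBall (0 : W') 1,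
      hemisphere W' u s x ∈ Z ∪ {x | x ∈ W' ∧ ‖x‖ = 1} ↔ √(1 - ‖x‖ ^ 2) = 0 := by
    intro s hs x hx
    have hn := norm_hemisphere hu hu1 hs (mem_closedBall_zero_iff.1 hx)
    have hs0 : s ≠ 0 := by rintro rfl; norm_num at hs
    constructor
    · rintro (h | ⟨h, -⟩)
      · exact (hZ _ h hn).elim
      · have h0 : inner ℝ u (hemisphere W' u s x) = (0 : ℝ) :=
          Submodule.inner_left_of_mem_orthogonal h hu
        rw [inner_hemisphere hu hu1] at h0
        exact (mul_eq_zero.1 h0).resolve_left hs0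
    · intro h
      refine .inr ⟨?_, hn⟩
      rw [hemisphere, h, mul_zero, zero_smul, add_zero]
      exact x.2
  have step₁ := hemi 1 (by norm_num) _ (hFZ.trans (hull_mono subset_union_left))
    (memA 1 (by norm_num))
  have step₂ := hemi (-1) (by norm_num) (Z ∪ {x | x ∈ W' ∧ ‖x‖ = 1} ∪
    hemisphere W' u 1 '' Metric.closedBall 0 1)
    (hFZ.trans (hull_mono (subset_union_left.trans subset_union_left))) (fun x hx => by
      rw [mem_union, memA (-1) (by norm_num) x hx]
      refine ⟨fun h => h.elim id ?_, .inl⟩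
      rintro ⟨y, hy, hyx⟩
      obtain ⟨rfl, h⟩ := hemisphere_eq_hemisphere hu hu1 hyx
      linarith)
  have hfinal : Z ∪ {x | x ∈ W' ∧ ‖x‖ = 1} ∪ hemisphere W' u 1 '' Metric.closedBall 0 1 ∪
      hemisphere W' u (-1) '' Metric.closedBall 0 1 = Z ∪ {x | x ∈ W ∧ ‖x‖ = 1} := by
    have hsub : ∀ s : ℝ, s ^ 2 = 1 → hemisphere W' u s '' Metric.closedBall 0 1 ⊆
        {x | x ∈ W ∧ ‖x‖ = 1} := by
      rintro s hs _ ⟨x, hx, rfl⟩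
      exact ⟨W.add_mem x.2.1 (W.smul_mem _ huW),
        norm_hemisphere hu hu1 hs (mem_closedBall_zero_iff.1 hx)⟩
    refine Subset.antisymm ?_ ?_
    · refine union_subset (union_subset (union_subset subset_union_left ?_) ?_) ?_
      · exact fun x hx => .inr ⟨hx.1.1, hx.2⟩
      · exact (hsub 1 (by norm_num)).trans subset_union_right
      · exact (hsub (-1) (by norm_num)).trans subset_union_right
    · rintro y (hy | ⟨hyW, hy⟩)
      · exact .inl (.inl (.inl hy))
      · obtain ⟨x, hx, h⟩ := exists_hemisphere_eq (W := W') hu hu1 hy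
          ⟨W.sub_mem hyW (W.smul_mem _ huW), by
            rw [SetLike.mem_coe, Submodule.mem_orthogonal_singleton_iff_inner_right, inner_sub_right,
              inner_smul_right, real_inner_self_eq_norm_sq, hu1]
            ring⟩
        rcases h with h | h
        · exact .inl (.inr ⟨x, mem_closedBall_zero_iff.2 hx, h⟩)
        · exact .inr ⟨x, mem_closedBall_zero_iff.2 hx, h⟩
  rw [← hfinal]
  exact (ih W' hlt).trans (step₁.trans step₂)

/-! ### Assembling the decomposition -/

/-- Once the sphere and the lines through the states are present, the rest of the disk is one convex
body to attach. -/
theorem isFiniteCellExt_univ {Z : Set (EuclideanSpace ℝ (Fin n))} (hZ : Z.Finite)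
    (hF : F ⊆ hull Z) :
    IsFiniteCellExt (globeSubdiv n F) (hull (Metric.sphere 0 1 ∪ Z)) univ := by
  have hint : interior (Metric.closedBall (0 : EuclideanSpace ℝ (Fin n)) 1) = Metric.ball 0 1 :=
    interior_closedBall _ one_ne_zero
  have h := isFiniteCellExt_convex (F := F) hZ _ _ rfl (convex_closedBall 0 1)
    (isCompact_closedBall (0 : EuclideanSpace ℝ (Fin n)) 1)
    (by rw [hint]; exact ⟨0, Metric.mem_ball_self one_pos⟩) (j := id) continuousOn_id
    (injOn_id _) (mapsTo_id _) rfl (A := Metric.sphere 0 1 ∪ Z)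
    (hF.trans (hull_mono subset_union_right)) (fun x hx => by
      rw [hint, mem_union, id, mem_sphere_zero_iff_norm, mem_ball_zero_iff, not_lt]
      exact or_congr_left ⟨fun h => h.ge, fun h => le_antisymm (mem_closedBall_zero_iff.1 hx) h⟩)
  refine (congrArg (IsFiniteCellExt (globeSubdiv n F) _) ?_).mp h
  refine eq_univ_of_forall fun x => ?_
  obtain ⟨z, t, rfl⟩ := exists_pt (Z := Disk n) x
  exact pt_mem_hull.2 (.inr (.inr (.inr ⟨z, z.2, rfl⟩)))

/-- When all the states are present, the finitely many lines that contain them can be added. -/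
theorem isFiniteCellExt_hull_union (hFf : F.Finite) (A : Set (EuclideanSpace ℝ (Fin n)))
    {Z : Set (EuclideanSpace ℝ (Fin n))} (hZ : Z.Finite) (hZb : Z ⊆ Metric.closedBall 0 1)
    (hF : F ⊆ hull Z) : IsFiniteCellExt (globeSubdiv n F) (hull A ∪ F) (hull (A ∪ Z)) := by
  have h := isFiniteCellExt_lines hFf A hZ hZb
  have e : hull (A ∪ Z) ∪ F = hull (A ∪ Z) :=
    union_eq_left.2 (hF.trans (hull_mono subset_union_right))
  exact (congrArg (IsFiniteCellExt (globeSubdiv n F) _) e).mp h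

end Sphere

namespace MDSpace

/-- A multipointed `d`-space without points is initial. -/
def isInitialOfIsEmpty (X : MDSpace) [IsEmpty X.carrier] : IsInitial X :=
  IsInitial.ofUniqueHom
    (fun _ => { map := ⟨isEmptyElim, continuous_of_const fun x => isEmptyElim x⟩
                map_states := fun x => isEmptyElim x
                map_exec := fun γ => isEmptyElim (γ 0) })
    (fun _ _ => Hom.ext (ContinuousMap.ext fun x => isEmptyElim x))

/-- A `Δ`-Hausdorff multipointed `d`-space without points is initial. -/
def isInitialHOfIsEmpty (X : MDSpaceH) [IsEmpty X.obj.carrier] : IsInitial X :=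
  IsInitial.ofUniqueHom (fun _ => ObjectProperty.homMk ((isInitialOfIsEmpty X.obj).to _))
    (fun _ _ => ObjectProperty.hom_ext _ ((isInitialOfIsEmpty X.obj).hom_ext _ _))

theorem not_isIso_subIncl {X : MDSpace} [T2Space X.carrier] {B B' : Set X.carrier}
    (hB : DeltaGeneratedSpace B) (hB' : DeltaGeneratedSpace B') (h : B ⊆ B') {x : X.carrier}
    (hx : x ∈ B') (hx' : x ∉ B) : ¬ IsIso (subIncl hB hB' h) := by
  intro hi
  have h1 : (inv (subIncl hB hB' h)).hom ≫ (subIncl hB hB' h).hom = 𝟙 _ :=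
    congrArg InducedCategory.Hom.hom (IsIso.inv_hom_id (subIncl hB hB' h))
  have h2 := congrArg Subtype.val (hom_apply_eq h1 ⟨x, hx⟩)
  have h3 := ((inv (subIncl hB hB' h)).hom.map ⟨x, hx⟩).2
  have h4 : ((inv (subIncl hB hB' h)).hom.map ⟨x, hx⟩).1 = x := h2
  exact hx' (h4 ▸ h3)

/-- The whole space, as a subset of itself. -/
def subUnivIso (X : MDSpace) (h : DeltaGeneratedSpace (univ : Set X.carrier)) :
    X.sub univ h ≅ X :=
  isoOfHomeomorph
    { map := X.val univ
      map_states := fun _ hx => hx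
      map_exec := fun _ hγ => hγ }
    (Homeomorph.Set.univ X.carrier) (fun _ => rfl) (fun _ h => h) (fun _ h => h)

end MDSpace

section Decomposition

variable {n : ℕ} {F : Set (GlobeSpace (Disk n))}

/-- The globe of the sphere is the subspace of the globe of the disk given by the lines through the
points of the sphere. -/
noncomputable def globeSphereHomeomorph (n : ℕ) :
    GlobeSpace (BdSphere n) ≃ₜ
      (hull (Metric.sphere (0 : EuclideanSpace ℝ (Fin n)) 1) : Set (GlobeSpace (Disk n))) :=
  haveI : T2Space (GlobeSpace (Disk n)) := GlobeSpace.t2Space_of_subset _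
  Continuous.homeoOfEquivCompactToT2
    (f := Equiv.ofBijective (fun x => ⟨GlobeSpace.map (sphereIncl n) x, by
        induction x using GlobeSpace.ind with
        | h0 => exact zero_mem_hull _
        | h1 => exact one_mem_hull _
        | h z t => exact .inr (.inr ⟨sphereIncl n z, t, z.2, rfl⟩)⟩) (by
      constructor
      · intro x y h
        exact map_injective (inclusion_injective Metric.sphere_subset_closedBall)
          (congrArg Subtype.val h)
      · rintro ⟨x, rfl | rfl | ⟨z, t, hz, rfl⟩⟩
        · exact ⟨zero _, rfl⟩
        · exact ⟨one _, rfl⟩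
        · exact ⟨pt ⟨z, hz⟩ t, rfl⟩))
    ((GlobeSpace.map (sphereIncl n)).continuous.subtype_mk _)

theorem deltaGeneratedSpace_hull_sphere (n : ℕ) : DeltaGeneratedSpace
    (hull (Metric.sphere (0 : EuclideanSpace ℝ (Fin n)) 1) : Set (GlobeSpace (Disk n))) :=
  (globeSphereHomeomorph n).isQuotientMap.isGeneratedBy

theorem isClosed_hull_sphere (n : ℕ) : IsClosed
    (hull (Metric.sphere (0 : EuclideanSpace ℝ (Fin n)) 1) : Set (GlobeSpace (Disk n))) := by
  have : T2Space (GlobeSpace (Disk n)) := GlobeSpace.t2Space_of_subset _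
  have := (globeSphereHomeomorph n).compactSpace
  exact (isCompact_iff_compactSpace.2 this).isClosed

/-- The globe of the sphere as a subobject of the subdivided globe, when none of the additional
states lies in it. -/
noncomputable def globeSphereIso (hF : Disjoint F (hull (Metric.sphere 0 1))) :
    globe (BdSphere n) ≅ (globeSubdiv n F).sub (hull (Metric.sphere 0 1))
      (deltaGeneratedSpace_hull_sphere n) :=
  MDSpace.isoOfHomeomorph
    { map := ⟨globeSphereHomeomorph n, (globeSphereHomeomorph n).continuous⟩
      map_states := (subdivIncl n F).map_states
      map_exec := (subdivIncl n F).map_exec }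
    (globeSphereHomeomorph n) (fun _ => rfl)
    (by
      intro x hx
      have hx' : GlobeSpace.map (sphereIncl n) x ∈ (globe (Disk n)).states :=
        Or.resolve_right hx fun h => hF.le_bot ⟨h, (globeSphereHomeomorph n x).2⟩
      rcases hx' with h | h
      · exact .inl (map_injective (inclusion_injective Metric.sphere_subset_closedBall)
          (h : _ = GlobeSpace.map (sphereIncl n) (zero _)))
      · exact .inr (map_injective (inclusion_injective Metric.sphere_subset_closedBall)
          (h : _ = GlobeSpace.map (sphereIncl n) (one _))))
    (by
      intro γ hγ
      obtain ⟨hd, hs, ht, hne⟩ := hγ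
      obtain ⟨z, φ, hφ, he⟩ := mem_dpaths_iff.1 hd
      have hγ' : ∀ t, GlobeSpace.map (sphereIncl n) (γ t) = pt z (φ t) := fun t =>
        DFunLike.congr_fun he t
      have hmem : ∀ t, pt z (φ t) ∈ hull (Metric.sphere 0 1) := fun t =>
        hγ' t ▸ (globeSphereHomeomorph n (γ t)).2
      have hends : ∀ t, pt z (φ t) ∈ (globe (Disk n)).states ∪ F → φ t = 0 ∨ φ t = 1 := by
        rintro t ((h | h) | h)
        · exact .inl (congrArg height h)
        · exact .inr (congrArg height h)
        · exact (hF.le_bot ⟨h, hmem t⟩).elim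
      have h0 := hends 0 (hγ' 0 ▸ hs)
      have h1 := hends 1 (hγ' 1 ▸ ht)
      have hne' : φ 0 ≠ φ 1 := fun h => hne (by
        have := (hγ' 0).trans ((congrArg (pt z) h).trans (hγ' 1).symm)
        exact this)
      have h0' : φ 0 = 0 := h0.resolve_right fun h =>
        hne' (le_antisymm (hφ nonneg') (le_one'.trans h.ge))
      have h1' : φ 1 = 1 := h1.resolve_left fun h => hne' (h0'.trans h.symm)
      obtain ⟨u, hu⟩ := exists_unitInterval_apply_eq (φ := φ) (c := ⟨1 / 2, by norm_num⟩)
        (h0'.le.trans nonneg') (le_one'.trans h1'.ge)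
      have hz : (z : EuclideanSpace ℝ (Fin n)) ∈ Metric.sphere 0 1 := by
        have := pt_mem_hull.1 (hmem u)
        rw [hu] at this
        refine (this.resolve_left fun h => ?_).resolve_left fun h => ?_
        · have := congrArg Subtype.val h; norm_num at this
        · have := congrArg Subtype.val h; norm_num at this
      refine ⟨⟨z, hz⟩, φ, mem_reparamM hφ h0' h1', ContinuousMap.ext fun t => ?_⟩
      exact map_injective (inclusion_injective Metric.sphere_subset_closedBall) (hγ' t))

/-- The points of the disk on whose line a point of `F` lies form a finite set `Z` in the open
ball. -/
theorem exists_finite_subset_hull (hF : F.Finite)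
    (hFint : ∀ x ∈ F, x ∉ Set.range (globeIncl n).map) :
    ∃ Z : Set (EuclideanSpace ℝ (Fin n)), Z.Finite ∧ Z ⊆ Metric.closedBall 0 1 ∧
      (∀ z ∈ Z, ‖z‖ ≠ 1) ∧ F ⊆ hull Z := by
  choose z t h using exists_pt (Z := Disk n)
  refine ⟨(fun x => (z x : EuclideanSpace ℝ (Fin n))) '' F, hF.image _, ?_, ?_, ?_⟩
  · rintro _ ⟨x, _, rfl⟩
    exact (z x).2
  · rintro _ ⟨x, hx, rfl⟩ hz
    refine hFint x hx ?_
    rw [h x]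
    exact (mem_range_globeIncl _ _).2 (.inr (.inr hz))
  · intro x hx
    exact .inr (.inr ⟨z x, t x, ⟨x, hx, rfl⟩, h x⟩)

theorem disjoint_hull_sphere (hFint : ∀ x ∈ F, x ∉ Set.range (globeIncl n).map) :
    Disjoint F (hull (Metric.sphere 0 1)) := by
  refine Set.disjoint_left.2 fun x hx hx' => hFint x hx ?_
  rcases hx' with rfl | rfl | ⟨z, t, hz, rfl⟩
  · exact ⟨zero _, rfl⟩
  · exact ⟨one _, rfl⟩
  · exact ⟨pt ⟨z, hz⟩ t, rfl⟩

/-- The relative decomposition: the states of `F`, then the lines through them, then the disk.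
The center of the globe is not in the globe of the sphere, so the inclusion is no isomorphism and
the identifications with `globeSphereH` and `globeSubdivH` can be absorbed into the cells. -/
theorem subdivInclH_mem_multiplicativeClosure (hF : F.Finite)
    (hFint : ∀ x ∈ F, x ∉ Set.range (globeIncl n).map) :
    attachments.multiplicativeClosure (subdivInclH n F) := by
  obtain ⟨Z, hZ, hZb, -, hFZ⟩ := exists_finite_subset_hull hF hFint
  obtain ⟨hsub, h⟩ : IsFiniteCellExt (globeSubdiv n F) (hull (Metric.sphere 0 1)) univ :=
    (isFiniteCellExt_union_states (fun _ => globeSubdiv_ne) hF fun _ hx => .inr hx).trans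
      ((isFiniteCellExt_hull_union hF _ hZ hZb hFZ).trans (isFiniteCellExt_univ hZ hFZ))
  obtain ⟨_, hu, h⟩ := h (deltaGeneratedSpace_hull_sphere n) (isClosed_hull_sphere n)
  have hc : pt (⟨0, by simp⟩ : Disk n) ⟨1 / 2, by norm_num⟩ ∉ hull (Metric.sphere 0 1) := by
    rw [pt_mem_hull]
    rintro (h | h | h)
    · have := congrArg Subtype.val h; norm_num at this
    · have := congrArg Subtype.val h; norm_num at this
    · simp at h
  exact MorphismProperty.multiplicativeClosure_iso_comp_iso h
    (not_isIso_subIncl _ _ _ (mem_univ _) hc)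
    (MDSpace.isDeltaHausdorff.isoMk (X := globeSphereH n)
      (globeSphereIso (disjoint_hull_sphere hFint)))
    (MDSpace.isDeltaHausdorff.isoMk (Y := globeSubdivH n F) (subUnivIso _ hu))

/-- The absolute decomposition, from the empty space. The lines through `F` come before the sphere,
because all the states have to be present when cells of the disk are attached. -/
theorem exists_isEmpty_multiplicativeClosure (hF : F.Finite)
    (hFint : ∀ x ∈ F, x ∉ Set.range (globeIncl n).map) :
    ∃ (E : MDSpaceH) (_ : IsEmpty E.obj.carrier) (f : E ⟶ globeSubdivH n F),
      attachments.multiplicativeClosure f := by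
  obtain ⟨Z, hZ, hZb, hZ1, hFZ⟩ := exists_finite_subset_hull hF hFint
  have hsph : hull (Z ∪ {x | x ∈ (⊤ : Submodule ℝ (EuclideanSpace ℝ (Fin n))) ∧ ‖x‖ = 1}) =
      hull (Metric.sphere 0 1 ∪ Z) := by
    rw [union_comm]
    congr 2
    ext x
    simp
  have hst : (globeSubdiv n F).states = hull ∅ ∪ F := by
    refine congrArg (· ∪ F) (Subset.antisymm ?_ ?_)
    · rintro x (rfl | rfl)
      · exact zero_mem_hull _
      · exact one_mem_hull _
    · rintro x (rfl | rfl | ⟨_, _, h, _⟩)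
      · exact .inl rfl
      · exact .inr rfl
      · exact h.elim
  have h₀ : IsFiniteCellExt (globeSubdiv n F) ∅ (hull ∅ ∪ F) := by
    have := isFiniteCellExt_union_states (X := globeSubdiv n F) (fun _ => globeSubdiv_ne)
      (B := ∅) ((toFinite {zero _, one _}).union hF : (globeSubdiv n F).states.Finite) subset_rfl
    exact (congrArg (IsFiniteCellExt (globeSubdiv n F) _) ((empty_union _).trans hst)).mp this
  have h₁ := isFiniteCellExt_hull_union hF ∅ hZ hZb hFZ
  rw [empty_union] at h₁
  have h₂ := isFiniteCellExt_sphere hFZ hZ1 ⊤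
  rw [hsph] at h₂
  obtain ⟨hsub, h⟩ := h₀.trans (h₁.trans (h₂.trans (isFiniteCellExt_univ hZ hFZ)))
  have hE : IsEmpty (∅ : Set (globeSubdiv n F).carrier) := inferInstance
  obtain ⟨_, hu, h⟩ := h (deltaGeneratedSpace_of_discrete _) isClosed_empty
  exact ⟨_, hE, _, MorphismProperty.multiplicativeClosure_iso_comp_iso h
    (not_isIso_subIncl _ _ _ (mem_univ (zero (Disk n))) (notMem_empty _))
    (Iso.refl _)
    (MDSpace.isDeltaHausdorff.isoMk (Y := globeSubdivH n F) (subUnivIso _ hu))⟩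

theorem IglC_le_genCof : IglC ≤ genCof := le_sup_left

theorem mainTheorem7 (n : ℕ) (F : Set (GlobeSpace (Disk n))) (hF : F.Finite)
    (hFint : ∀ x ∈ F, x ∉ Set.range (globeIncl n).map) :
    -- the states and the execution paths of the subdivided globe
    (globeSubdiv n F).states = {GlobeSpace.zero (Disk n), GlobeSpace.one (Disk n)} ∪ F ∧
    (∀ α ∈ (globeSubdiv n F).states, ∀ β ∈ (globeSubdiv n F).states, α ≠ β →
      (globeSubdiv n F).execFrom α β = (globe (Disk n)).Sp.pathsFrom α β) ∧
    (∀ α ∈ (globeSubdiv n F).states, (globeSubdiv n F).execFrom α α = ∅) ∧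
    -- over all `Δ`-generated spaces: finite composition of pushouts, and cellularity
    IglC.pushouts.multiplicativeClosure (subdivIncl n F) ∧
    IsCellular genCof (globeSubdiv n F) ∧
    -- the same over `Δ`-Hausdorff `Δ`-generated spaces
    (restrictH IglC).pushouts.multiplicativeClosure (subdivInclH n F) ∧
    IsCellular (restrictH genCof) (globeSubdivH n F) := by
  have h := subdivInclH_mem_multiplicativeClosure hF hFint
  obtain ⟨E, hE, f, hf⟩ := exists_isEmpty_multiplicativeClosure hF hFint
  refine ⟨rfl, ?_, ?_, multiplicativeClosure_pushouts_of_attachments h, ?_,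
    MorphismProperty.multiplicativeClosure_monotone attachments_le_pushouts _ h, ?_⟩
  · intro α hα β hβ hne
    ext γ
    constructor
    · rintro ⟨hγ, h0, h1⟩
      exact ⟨hγ.1, h0, h1⟩
    · rintro ⟨hγ, rfl, rfl⟩
      exact ⟨⟨hγ, hα, hβ, hne⟩, rfl, rfl⟩
  · intro α _
    refine eq_empty_of_forall_notMem ?_
    rintro γ ⟨hγ, h0, h1⟩
    exact hγ.2.2.2 (h0.trans h1.symm)
  · refine ⟨E.obj, isInitialOfIsEmpty E.obj, ?_⟩
    have e : (isInitialOfIsEmpty E.obj).to (globeSubdiv n F) = f.hom :=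
      (isInitialOfIsEmpty E.obj).hom_ext _ _
    rw [e]
    exact MorphismProperty.transfiniteCompositions_monotone
      (MorphismProperty.pushouts_monotone IglC_le_genCof) _
      (MorphismProperty.transfiniteCompositions_of_multiplicativeClosure
        (multiplicativeClosure_pushouts_of_attachments hf))
  · refine ⟨E, isInitialHOfIsEmpty E, ?_⟩
    rw [(isInitialHOfIsEmpty E).hom_ext ((isInitialHOfIsEmpty E).to _) f]
    have hle : restrictH IglC ≤ restrictH genCof := fun _ _ _ h => IglC_le_genCof _ h
    exact MorphismProperty.transfiniteCompositions_monotone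
      (MorphismProperty.pushouts_monotone hle) _
      (MorphismProperty.transfiniteCompositions_of_multiplicativeClosure
        (MorphismProperty.multiplicativeClosure_monotone attachments_le_pushouts _ hf))

end Decomposition
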